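/- **Setting.** Let $T\in\mathbb N$, let $\pi_0,\dots,\pi_T$ be probability measures on measurable spaces $\mathcal C_0,\dots,\mathcal C_T$, and for $1\le l\le T$ let $\bar k_l$ be a Markov kernel from $\mathcal C_{l-1}$ to $\mathcal C_l\times\mathbb R_{>0}$. Write $(C_l,W_l)\sim\bar k_l(c_{l-1},\cdot)$ for the new particle and its strictly positive random weight, and for a function $\psi$ of $(C_l,W_l)$ put $\mathbb E_{\tilde\pi_l}[\psi(C_l,W_l)]=\mathbb E_{\pi_{l-1}}\big[\mathbb E_{\bar k_l(C_{l-1},\cdot)}[\psi(C_l,W_l)]\big]$. Assume that the weights are unbiased: there are constants $z_l$ with $\mathbb E_{\tilde\pi_l}[W_l\,\phi(C_l)]=z_l\,\mathbb E_{\pi_l}[\phi]$ for all $\phi\in L^1(\mathcal C_l,\pi_l)$. Put $V_l=W_l/z_l$. For every number of particles $H$ run random-weight sequential Monte Carlo: $\hat C_0^{1,H},\dots,\hat C_0^{H,H}$ are i.i.d. with law $\pi_0$; for $t=1,\dots,T$, given everything generated before in the run with $H$ particles, the pairs $(C_t^{j,H},W_t^{j,H})$, $1\le j\le H$, are independent with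 $(C_t^{j,H},W_t^{j,H})\sim\bar k_t(\hat C_{t-1}^{j,H},\cdot)$; then (multinomial resampling), given everything generated before in that run, $\hat C_t^{1,H},\dots,\hat C_t^{H,H}$ are i.i.d. draws from $\sum_{i=1}^H \frac{W_t^{i,H}}{\sum_{k=1}^H W_t^{k,H}}\,\delta_{C_t^{i,H}}$. Nothing is assumed about the joint law of the runs for different $H$; in particular they may be independent. **Theorem (Central Limit Theorem).** Let $A_0=L^2(\mathcal C_0,\pi_0)$ and, for $l\ge1$, $$A_l=\Big\{\phi_l\in L^2(\mathcal C_l,\pi_l)\;\Big|\;c_{l-1}\mapsto\mathbb E_{\bar k_l(c_{l-1},\cdot)}[V_l\phi_l(C_l)]\in A_{l-1},\ \ \mathbb E_{\tilde\pi_l}\big[|V_l\phi_l(C_l)|^2\big]<\infty\Big\}.$$ Define $\hat\Sigma_0(\phi)=\mathrm{Var}_{\pi_0}(\phi)$ and, for $t\ge1$, $$\tilde\Sigma_t(\psi)=\hat\Sigma_{t-1}\big(\mathbb E_{\bar k_t}[\psi]\big)+\mathbb E_{\pi_{t-1}}\big[\mathrm{Var}_{\bar k_t}(\psi)\big],\qquad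 \Sigma_t(\phi)=\tilde\Sigma_t\big(V_t(\phi-\mathbb E_{\pi_t}[\phi])\big),\qquad \hat\Sigma_t(\phi)=\Sigma_t(\phi)+\mathrm{Var}_{\pi_t}(\phi),$$ where, for a function $\psi$ of $(C_t,W_t)$, $\mathbb E_{\bar k_t}[\psi]$ and $\mathrm{Var}_{\bar k_t}(\psi)$ are the functions of $c_{t-1}$ giving the mean and the variance of $\psi(C_t,W_t)$ under $\bar k_t(c_{t-1},\cdot)$. Let $0\le t\le T$, assume that the constant function $1$ lies in $A_l$ for all $0\le l\le t$, and let $\phi_t\in A_t$. Then, as $H\to\infty$, if $t\ge1$, $$\sqrt H\left\{\sum_{j=1}^H\frac{W_t^{j,H}}{\sum_{k=1}^HW_t^{k,H}}\,\phi_t(C_t^{j,H})-\mathbb E_{\pi_t}[\phi_t]\right\}\ \overset{\mathcal D}{\longrightarrow}\ \mathcal N\big(0,\Sigma_t(\phi_t)\big),$$ and, for all $t\ge 0$, $$\frac1{\sqrt H}\sum_{j=1}^H\big\{\phi_t(\hat C_t^{j,H})-\mathbb E_{\pi_t}[\phi_t]\big\}\ \overset{\mathcal D}{\longrightarrow}\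 \mathcal N\big(0,\hat\Sigma_t(\phi_t)\big),$$ where $\mathcal N(0,0)$ is the Dirac mass at $0$. -/

import Mathlib

open MeasureTheory ProbabilityTheory Filter Topology

noncomputable section

namespace RWSMC

section Model

variable {E F : Type*} [MeasurableSpace E] [MeasurableSpace F]

/-- The space of strictly positive weights. -/
abbrev PosWeight : Type := Set.Ioi (0 : ℝ)

/-- The normalised weight `V = W / z` as a function of a pair (particle, weight). -/
def normWeight (z : ℝ) (x : F × PosWeight) : ℝ := (x.2 : ℝ) / z

/-- The weights produced by the generalised kernel `κ` are unbiased: if the old particle has law `μ`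
and `(C, W)` is drawn from `κ`, then `E[W φ(C)] = z E_ν[φ]` (and the left-hand expectation exists)
for every `φ ∈ L¹(ν)`. The measure `κ ∘ₘ μ` is the law of `(C, W)`. -/
def UnbiasedWeights (μ : Measure E) (κ : Kernel E (F × PosWeight)) (z : ℝ) (ν : Measure F) : Prop :=
  ∀ φ : F → ℝ, Integrable φ ν →
    Integrable (fun x : F × PosWeight => (x.2 : ℝ) * φ x.1) (κ ∘ₘ μ) ∧
      ∫ x, (x.2 : ℝ) * φ x.1 ∂(κ ∘ₘ μ) = z * ∫ c, φ c ∂ν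

/-- One mutation step of the variance recursion: for a variance functional `S` on the previous level,
`ψ ↦ S(E_κ[ψ]) + E_μ[Var_κ(ψ)]`. -/
def varMutation (S : (E → ℝ) → ℝ) (μ : Measure E) (κ : Kernel E F) (ψ : F → ℝ) : ℝ :=
  S (fun c => ∫ x, ψ x ∂(κ c)) + ∫ c, Var[ψ; κ c] ∂μ

/-- Mutation followed by correction: `φ ↦ varMutation (V (φ - E_ν[φ]))`. -/
def varCorrection (S : (E → ℝ) → ℝ) (μ : Measure E) (κ : Kernel E (F × PosWeight)) (z : ℝ)
    (ν : Measure F) (φ : F → ℝ) : ℝ :=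
  varMutation S μ κ (fun x => normWeight z x * (φ x.1 - ∫ c, φ c ∂ν))

variable {𝒞 : ℕ → Type*} [∀ t, MeasurableSpace (𝒞 t)]
  (π : ∀ t, Measure (𝒞 t)) (k : ∀ t, Kernel (𝒞 t) (𝒞 (t + 1) × PosWeight)) (z : ℕ → ℝ)

/-- The classes `A_l` of test functions. The kernel `k l` leads from level `l` to level `l + 1`, and
`z (l + 1)` is the normalising constant of the weights of level `l + 1`. -/
def testClass : ∀ l, Set (𝒞 l → ℝ)
  | 0 => {φ | MemLp φ 2 (π 0)}
  | l + 1 => {φ | MemLp φ 2 (π (l + 1)) ∧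
      (fun c => ∫ x, normWeight (z (l + 1)) x * φ x.1 ∂(k l c)) ∈ testClass l ∧
      MemLp (fun x : 𝒞 (l + 1) × PosWeight => normWeight (z (l + 1)) x * φ x.1) 2 (k l ∘ₘ π l)}

/-- The asymptotic variance after resampling on level `t`. -/
def sigmaHat : ∀ t, (𝒞 t → ℝ) → ℝ
  | 0 => fun φ => Var[φ; π 0]
  | t + 1 => fun φ =>
      varCorrection (sigmaHat t) (π t) (k t) (z (t + 1)) (π (t + 1)) φ + Var[φ; π (t + 1)]

/-- The asymptotic variance of the mutated particles on level `t + 1`, as a functional of functions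
of particle and weight. -/
def sigmaTilde (t : ℕ) (ψ : 𝒞 (t + 1) × PosWeight → ℝ) : ℝ :=
  varMutation (sigmaHat π k z t) (π t) (k t) ψ

/-- The asymptotic variance before resampling (ratio estimator) on level `t + 1`. -/
def sigma (t : ℕ) (φ : 𝒞 (t + 1) → ℝ) : ℝ :=
  sigmaTilde π k z t (fun x => normWeight (z (t + 1)) x * (φ x.1 - ∫ c, φ c ∂π (t + 1)))

theorem sigmaHat_zero (φ : 𝒞 0 → ℝ) : sigmaHat π k z 0 φ = Var[φ; π 0] := rfl

theorem sigmaHat_succ (t : ℕ) (φ : 𝒞 (t + 1) → ℝ) :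
    sigmaHat π k z (t + 1) φ = sigma π k z t φ + Var[φ; π (t + 1)] := rfl

/-- The variances are non-negative, so that their conversion to `ℝ≥0` loses nothing. -/
theorem sigmaHat_nonneg (t : ℕ) (φ : 𝒞 t → ℝ) : 0 ≤ sigmaHat π k z t φ := by
  induction t with
  | zero => exact variance_nonneg _ _
  | succ t ih =>
    exact add_nonneg (add_nonneg (ih _) (integral_nonneg fun _ => variance_nonneg _ _))
      (variance_nonneg _ _)

theorem sigma_nonneg (t : ℕ) (φ : 𝒞 (t + 1) → ℝ) : 0 ≤ sigma π k z t φ :=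
  add_nonneg (sigmaHat_nonneg π k z t _) (integral_nonneg fun _ => variance_nonneg _ _)

end Model

section Algorithm

/-- `ρ ω` is a version of the conditional law of `X` given the σ-algebra `m`. -/
def HasCondLaw {Ω E : Type*} [MeasurableSpace E] (X : Ω → E) (m : MeasurableSpace Ω)
    (ρ : Ω → Measure E) {mΩ : MeasurableSpace Ω} (P : Measure Ω) : Prop :=
  ∀ s : Set E, MeasurableSet s → P⟦X ⁻¹' s | m⟧ =ᵐ[P] fun ω => (ρ ω).real s

/-- The weighted empirical measure `∑ i, (w i / ∑ l, w l) δ_(c i)`. -/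
def weightedEmpirical {E : Type*} [MeasurableSpace E] {H : ℕ} (c : Fin H → E)
    (w : Fin H → PosWeight) : Measure E :=
  ∑ i, ENNReal.ofReal ((w i : ℝ) / ∑ l, (w l : ℝ)) • Measure.dirac (c i)

variable {𝒞 : ℕ → Type*} [∀ t, MeasurableSpace (𝒞 t)] {Ω : Type*}
  (Chat : ∀ t H : ℕ, Fin H → Ω → 𝒞 t)
  (C : ∀ t H : ℕ, Fin H → Ω → 𝒞 (t + 1))
  (W : ∀ _t H : ℕ, Fin H → Ω → PosWeight)

/-- The σ-algebra generated by the resampled particles of row `H` on level `t`. -/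
abbrev sigmaAlgHat (t H : ℕ) : MeasurableSpace Ω :=
  ⨆ j, MeasurableSpace.comap (Chat t H j) inferInstance

/-- The σ-algebra generated by the weighted particles of row `H` on level `t + 1`. -/
abbrev sigmaAlgWeighted (t H : ℕ) : MeasurableSpace Ω :=
  ⨆ j, MeasurableSpace.comap (fun ω => (C t H j ω, W t H j ω)) inferInstance

/-- Everything that row `H` has generated up to and including the selection step of level `t`. -/
abbrev historyHat (t H : ℕ) : MeasurableSpace Ω :=
  (⨆ s ≤ t, sigmaAlgHat Chat s H) ⊔ ⨆ s < t, sigmaAlgWeighted C W s H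

/-- Everything that row `H` has generated up to and including the mutation and correction step of
level `t + 1`. -/
abbrev historyWeighted (t H : ℕ) : MeasurableSpace Ω :=
  historyHat Chat C W t H ⊔ sigmaAlgWeighted C W t H

/-- The arrays `Chat`, `C`, `W` are produced, for every number `H` of particles, by random-weight
sequential Monte Carlo with multinomial resampling, run up to level `T`. Here `Chat t H j` is the
`j`-th resampled particle of level `t`, while `C t H j` and `W t H j` are the `j`-th mutated
particle and its weight on level `t + 1`. No assumption is made on the joint law of different
rows `H`. -/
structure IsRandomWeightSMC [MeasurableSpace Ω] (T : ℕ) (π₀ : Measure (𝒞 0))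
    (k : ∀ t, Kernel (𝒞 t) (𝒞 (t + 1) × PosWeight)) (P : Measure Ω) : Prop where
  measurable_hat : ∀ t ≤ T, ∀ H j, Measurable (Chat t H j)
  measurable_particle : ∀ t < T, ∀ H j, Measurable (C t H j)
  measurable_weight : ∀ t < T, ∀ H j, Measurable (W t H j)
  /-- The initial particles are i.i.d. with law `π₀`. -/
  initial : ∀ H, P.map (fun ω j => Chat 0 H j ω) = Measure.pi fun _ : Fin H => π₀
  /-- Mutation and correction: given the past, the pairs `(C, W)` are independent, and the `j`-th one
  is drawn from the kernel started at the `j`-th resampled particle. -/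
  mutation : ∀ t < T, ∀ H,
    HasCondLaw (fun ω j => (C t H j ω, W t H j ω)) (historyHat Chat C W t H)
      (fun ω => Measure.pi fun j : Fin H => k t (Chat t H j ω)) P
  /-- Multinomial resampling: given the past, the new particles are independent draws from the
  weighted empirical measure. -/
  selection : ∀ t < T, ∀ H,
    HasCondLaw (fun ω j => Chat (t + 1) H j ω) (historyWeighted Chat C W t H)
      (fun ω => Measure.pi fun _ : Fin H =>
        weightedEmpirical (fun i => C t H i ω) (fun i => W t H i ω)) P

end Algorithm

end RWSMC

end

/-!
# Central limit theorem for random-weight sequential Monte Carlo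

Every step of the algorithm, including the initial draw, produces a row of `H` random variables
that are independent given some earlier random variable `Y H`, the `j`-th one with law
`κ H j (Y H)`. Only this structure is used, and it is recorded in `IsCondIndepArray`, together with
the assumption that the averages of the laws `κ H j (Y H)` satisfy a weak law of large numbers with
a limit measure `ν`. Two facts hold for such arrays.

* `IsCondIndepArray.tendstoInMeasure_avg`: the array itself satisfies the law of large numbers for
  every `f ∈ L¹(ν)`. So the assumption is handed on from step to step
  (`isCondIndepArray_mutation`, `isCondIndepArray_selection`), the resampling weights being a ratio
  of two convergent averages.
* `IsCondIndepArray.tendstoInDistribution_avg`: if the averages of the conditional means of `f` are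
  asymptotically `N(m, w / H)` and the averages of the conditional variances converge to `v`, then
  the averages of `f` over the array are asymptotically `N(m, (w + v) / H)`. Indeed the conditional
  characteristic function of the normalised centred sum converges in probability to
  `exp (-u² v / 2)`, while the conditional means contribute the factor `exp (-u² w / 2)`.

Both rest on estimates for a product of probability measures that hold outcome by outcome. For
bounded `f` they come from the second-order expansion of `exp (i x)`; a general `f` is approximated
by bounded functions in `L¹` or `L²`, and the law of large numbers controls the error.

The variance recursion of the theorem is then read off: mutation adds the mean conditional variance
of `V (φ - E[φ])` under the kernel, the passage to the ratio estimator costs nothing because the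
average of `V` tends to one (Slutsky), and multinomial resampling adds the variance of `φ` under the
target. Functions in `L²` are defined only up to null sets; as the weights are strictly positive,
unbiasedness forces the law of every particle to be absolutely continuous with respect to the target
of its level, so that they may be replaced by measurable functions.
-/

noncomputable section

namespace RWSMC

/-! ### Deterministic estimates for product measures -/

lemma norm_prod_sub_prod_le_sum {ι : Type*} (s : Finset ι) (a b : ι → ℂ) (ha : ∀ i, ‖a i‖ ≤ 1)
    (hb : ∀ i, ‖b i‖ ≤ 1) :
    ‖∏ i ∈ s, a i - ∏ i ∈ s, b i‖ ≤ ∑ i ∈ s, ‖a i - b i‖ := by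
  classical
  induction s using Finset.induction_on with
  | empty => simp
  | insert i s hi ih =>
    rw [Finset.prod_insert hi, Finset.prod_insert hi, Finset.sum_insert hi]
    have h1 : ‖∏ j ∈ s, b j‖ ≤ 1 := by
      rw [norm_prod]
      exact Finset.prod_le_one (fun _ _ => norm_nonneg _) fun j _ => hb j
    calc ‖a i * ∏ j ∈ s, a j - b i * ∏ j ∈ s, b j‖
        = ‖a i * (∏ j ∈ s, a j - ∏ j ∈ s, b j) + (a i - b i) * ∏ j ∈ s, b j‖ := by congr 1; ring
      _ ≤ ‖a i‖ * ‖∏ j ∈ s, a j - ∏ j ∈ s, b j‖ + ‖a i - b i‖ * ‖∏ j ∈ s, b j‖ := by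
          refine (norm_add_le _ _).trans ?_
          rw [norm_mul, norm_mul]
      _ ≤ 1 * ‖∏ j ∈ s, a j - ∏ j ∈ s, b j‖ + ‖a i - b i‖ * 1 := by
          gcongr
          exact ha i
      _ ≤ ‖a i - b i‖ + ∑ j ∈ s, ‖a j - b j‖ := by linarith

lemma norm_cexp_sub_taylor_le (x : ℝ) :
    ‖Complex.exp (Complex.I * x) - (1 + Complex.I * x - (x : ℂ) ^ 2 / 2)‖
      ≤ |x| ^ 3 * Real.exp |x| := by
  have h := Complex.norm_exp_sub_sum_le_norm_mul_exp (Complex.I * x) 3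
  have h2 : ‖Complex.I * (x : ℂ)‖ = |x| := by simp
  rw [h2] at h
  convert h using 3
  simp only [Finset.sum_range_succ, Finset.sum_range_zero, Nat.factorial, mul_pow, Complex.I_sq]
  push_cast
  ring

/-- The bound needs no upper restriction on `y`, so that it applies to every variance. -/
lemma abs_exp_neg_sub_le {y : ℝ} (hy : 0 ≤ y) : |Real.exp (-y) - (1 - y)| ≤ y ^ 2 := by
  have h1 := Real.one_sub_le_exp_neg y
  rw [abs_of_nonneg (by linarith)]
  rcases le_total y 1 with h | h
  · have := Real.abs_exp_sub_one_sub_id_le (x := -y) (by rwa [abs_neg, abs_of_nonneg hy])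
    have := le_abs_self (Real.exp (-y) - 1 - -y)
    nlinarith
  · have : Real.exp (-y) ≤ 1 := Real.exp_le_one_iff.2 (by linarith)
    nlinarith

lemma abs_exp_neg_sub_exp_neg_le {x y : ℝ} (hx : 0 ≤ x) (hy : 0 ≤ y) :
    |Real.exp (-x) - Real.exp (-y)| ≤ |x - y| := by
  wlog h : x ≤ y generalizing x y
  · rw [abs_sub_comm, abs_sub_comm x]
    exact this hy hx (le_of_not_ge h)
  rw [abs_of_nonneg (by simpa using h), abs_of_nonpos (by linarith)]
  have h1 := Real.one_sub_le_exp_neg (y - x)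
  have h2 : Real.exp (-y) = Real.exp (-x) * Real.exp (-(y - x)) := by
    rw [← Real.exp_add]; ring_nf
  have h3 : Real.exp (-x) ≤ 1 := Real.exp_le_one_iff.2 (by linarith)
  have h4 := Real.exp_pos (-x)
  rw [h2]
  nlinarith

lemma norm_cexp_I_mul_sub_le (x y : ℝ) :
    ‖Complex.exp (Complex.I * x) - Complex.exp (Complex.I * y)‖ ≤ |x - y| := by
  have h : Complex.exp (Complex.I * x) - Complex.exp (Complex.I * y)
      = Complex.exp (Complex.I * y) * (Complex.exp (Complex.I * ((x - y : ℝ) : ℂ)) - 1) := by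
    rw [mul_sub, ← Complex.exp_add]
    push_cast
    ring_nf
  rw [h, norm_mul, Complex.norm_exp_I_mul_ofReal, one_mul]
  exact Real.norm_exp_I_mul_ofReal_sub_one_le

section Single

variable {E : Type*} [MeasurableSpace E] {μ : Measure E} [IsProbabilityMeasure μ]

/-- Second-order expansion of the characteristic function of a bounded centred variable. -/
lemma norm_integral_cexp_sub_le {h : E → ℝ} (hm : Measurable h) {K : ℝ} (hK : ∀ x, |h x| ≤ K)
    (h0 : ∫ x, h x ∂μ = 0) (a : ℝ) :
    ‖∫ x, Complex.exp (Complex.I * ((a * h x : ℝ) : ℂ)) ∂μ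
        - (Real.exp (-(a ^ 2 / 2 * ∫ x, h x ^ 2 ∂μ)) : ℂ)‖
      ≤ (|a| * K) ^ 3 * Real.exp (|a| * K) + (|a| * K) ^ 4 := by
  have hK0 : 0 ≤ K := by
    obtain ⟨x⟩ : Nonempty E := μ.nonempty_of_neZero
    exact (abs_nonneg _).trans (hK x)
  have i1 : Integrable h μ := .of_bound hm.aestronglyMeasurable K (.of_forall hK)
  have hK2 : ∀ x, h x ^ 2 ≤ K ^ 2 := fun x => sq_le_sq.2 ((hK x).trans (le_abs_self K))
  have i2 : Integrable (fun x => h x ^ 2) μ :=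
    .of_bound (hm.pow_const 2).aestronglyMeasurable (K ^ 2)
      (.of_forall fun x => by rw [Real.norm_of_nonneg (sq_nonneg _)]; exact hK2 x)
  have i3 : Integrable (fun x => Complex.exp (Complex.I * ((a * h x : ℝ) : ℂ))) μ :=
    .of_bound (by fun_prop) 1 (.of_forall fun x => (Complex.norm_exp_I_mul_ofReal _).le)
  set q := ∫ x, h x ^ 2 ∂μ with hq
  have q0 : 0 ≤ q := integral_nonneg fun x => sq_nonneg _
  have qK : q ≤ K ^ 2 := by
    have := integral_mono i2 (integrable_const (K ^ 2)) hK2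
    simpa using this
  have hT : ∫ x, (1 + Complex.I * ((a * h x : ℝ) : ℂ) - ((a * h x : ℝ) : ℂ) ^ 2 / 2) ∂μ
      = ((1 - a ^ 2 / 2 * q : ℝ) : ℂ) := by
    have e : ∀ x, (1 + Complex.I * ((a * h x : ℝ) : ℂ) - ((a * h x : ℝ) : ℂ) ^ 2 / 2)
        = ((1 - a ^ 2 / 2 * h x ^ 2 : ℝ) : ℂ) + (Complex.I * a) * (h x : ℂ) := by
      intro x; push_cast; ring
    simp_rw [e]
    rw [integral_add, integral_const_mul, integral_complex_ofReal, integral_complex_ofReal, h0,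
      integral_sub (integrable_const _) (i2.const_mul _), integral_const_mul]
    · simp [hq]
    · exact ((integrable_const (1 : ℝ)).sub (i2.const_mul _)).ofReal
    · exact i1.ofReal.const_mul _
  have iT : Integrable
      (fun x => 1 + Complex.I * ((a * h x : ℝ) : ℂ) - ((a * h x : ℝ) : ℂ) ^ 2 / 2) μ := by
    refine .of_bound (by fun_prop) (1 + |a| * K + (|a| * K) ^ 2 / 2) (.of_forall fun x => ?_)
    have hb : |a * h x| ≤ |a| * K := by rw [abs_mul]; gcongr; exact hK x
    refine (norm_sub_le _ _).trans (add_le_add ((norm_add_le _ _).trans ?_) ?_)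
    · simpa using hb
    · rw [norm_div, norm_pow, Complex.norm_real, Real.norm_eq_abs, Complex.norm_ofNat]
      gcongr
  have s1 : ‖∫ x, Complex.exp (Complex.I * ((a * h x : ℝ) : ℂ)) ∂μ - ((1 - a ^ 2 / 2 * q : ℝ) : ℂ)‖
      ≤ (|a| * K) ^ 3 * Real.exp (|a| * K) := by
    rw [← hT, ← integral_sub i3 iT]
    refine (norm_integral_le_of_norm_le_const (C := (|a| * K) ^ 3 * Real.exp (|a| * K))
      (.of_forall fun x => ?_)).trans (by simp)
    have hb : |a * h x| ≤ |a| * K := by rw [abs_mul]; gcongr; exact hK x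
    refine (norm_cexp_sub_taylor_le _).trans ?_
    gcongr
  have s2 : ‖((1 - a ^ 2 / 2 * q : ℝ) : ℂ) - (Real.exp (-(a ^ 2 / 2 * q)) : ℂ)‖
      ≤ (|a| * K) ^ 4 := by
    rw [← Complex.ofReal_sub, Complex.norm_real, Real.norm_eq_abs, abs_sub_comm]
    refine (abs_exp_neg_sub_le (by positivity)).trans ?_
    have : (|a| * K) ^ 4 = (a ^ 2 * K ^ 2) ^ 2 := by
      rw [← sq_abs a]; ring
    rw [this]
    have : a ^ 2 / 2 * q ≤ a ^ 2 * K ^ 2 := by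
      have : a ^ 2 * q ≤ a ^ 2 * K ^ 2 := by gcongr
      nlinarith [mul_nonneg (sq_nonneg a) q0]
    exact pow_le_pow_left₀ (by positivity) this 2
  calc _ ≤ _ := norm_sub_le_norm_sub_add_norm_sub _ ((1 - a ^ 2 / 2 * q : ℝ) : ℂ) _
    _ ≤ _ := add_le_add s1 s2

/-- The variance is continuous for the `L²` seminorm, in a quantitative form. -/
lemma abs_variance_sub_variance_le {f g : E → ℝ} (hf : MemLp f 2 μ) (hg : MemLp g 2 μ) {η : ℝ}
    (hη : 0 < η) :
    |Var[f; μ] - Var[g; μ]|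
      ≤ η * ∫ x, f x ^ 2 ∂μ + (1 + 1 / η) * ∫ x, (f x - g x) ^ 2 ∂μ := by
  have vle : ∀ {h : E → ℝ}, MemLp h 2 μ → Var[h; μ] ≤ ∫ x, h x ^ 2 ∂μ := fun hh =>
    variance_le_expectation_sq hh.1
  have hd : MemLp (f - g) 2 μ := hf.sub hg
  have if1 := hf.integrable one_le_two
  have ig1 := hg.integrable one_le_two
  have hfc : MemLp (fun x => f x - ∫ y, f y ∂μ) 2 μ := hf.sub (memLp_const _)
  have hgc : MemLp (fun x => g x - ∫ y, g y ∂μ) 2 μ := hg.sub (memLp_const _)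
  have hdc : MemLp (fun x => (f - g) x - ∫ y, (f - g) y ∂μ) 2 μ := hd.sub (memLp_const _)
  have vf : Var[f; μ] = ∫ x, (f x - ∫ y, f y ∂μ) ^ 2 ∂μ :=
    variance_eq_integral hf.1.aemeasurable
  have vg : Var[g; μ] = ∫ x, (g x - ∫ y, g y ∂μ) ^ 2 ∂μ :=
    variance_eq_integral hg.1.aemeasurable
  have vd : Var[f - g; μ] = ∫ x, ((f - g) x - ∫ y, (f - g) y ∂μ) ^ 2 ∂μ :=
    variance_eq_integral hd.1.aemeasurable
  have hmean : ∫ y, (f - g) y ∂μ = ∫ y, f y ∂μ - ∫ y, g y ∂μ := integral_sub if1 ig1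
  calc |Var[f; μ] - Var[g; μ]|
      ≤ ∫ x, (η * (f x - ∫ y, f y ∂μ) ^ 2
          + (1 + 1 / η) * ((f - g) x - ∫ y, (f - g) y ∂μ) ^ 2) ∂μ := by
        rw [vf, vg, ← integral_sub hfc.integrable_sq hgc.integrable_sq]
        refine norm_integral_le_of_norm_le (μ := μ)
          (f := fun x => (f x - ∫ y, f y ∂μ) ^ 2 - (g x - ∫ y, g y ∂μ) ^ 2)
          ((hfc.integrable_sq.const_mul _).add (hdc.integrable_sq.const_mul _))
          (.of_forall fun x => ?_)
        rw [hmean, Real.norm_eq_abs, Pi.sub_apply]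
        have : f x - g x - (∫ y, f y ∂μ - ∫ y, g y ∂μ)
          = (f x - ∫ y, f y ∂μ) - (g x - ∫ y, g y ∂μ) := by ring
        rw [this]
        generalize f x - ∫ y, f y ∂μ = A at *
        generalize g x - ∫ y, g y ∂μ = B at *
        have key : 2 * |A| * |A - B| ≤ η * A ^ 2 + 1 / η * (A - B) ^ 2 := by
          have := sq_nonneg (η * |A| - |A - B|)
          have e : η * A ^ 2 + 1 / η * (A - B) ^ 2 - 2 * |A| * |A - B|
              = 1 / η * (η * |A| - |A - B|) ^ 2 := by
            rw [← sq_abs A, ← sq_abs (A - B)]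
            field_simp
            ring
          nlinarith [mul_nonneg (one_div_pos.2 hη).le this]
        have e : A ^ 2 - B ^ 2 = 2 * A * (A - B) - (A - B) ^ 2 := by ring
        rw [e]
        calc _ ≤ |2 * A * (A - B)| + |(A - B) ^ 2| := abs_sub _ _
          _ = 2 * |A| * |A - B| + (A - B) ^ 2 := by
            rw [abs_mul, abs_mul, abs_two, abs_of_nonneg (sq_nonneg (A - B))]
          _ ≤ _ := by linarith
    _ = η * Var[f; μ] + (1 + 1 / η) * Var[f - g; μ] := by
        rw [integral_add (hfc.integrable_sq.const_mul _) (hdc.integrable_sq.const_mul _),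
          integral_const_mul, integral_const_mul, vf, vd]
    _ ≤ _ := by
        gcongr
        · exact vle hf
        · exact vle hd

end Single

section Product

variable {ι E : Type*} [Fintype ι] [MeasurableSpace E] {μ : ι → Measure E}

/-- The centred sum `∑ i, (f (x i) - E_(μ i)[f])`. -/
def centredSum (μ : ι → Measure E) (f : E → ℝ) (x : ι → E) : ℝ :=
  ∑ i, (f (x i) - ∫ y, f y ∂(μ i))

lemma measurable_centredSum {f : E → ℝ} (hf : Measurable f) : Measurable (centredSum μ f) := by
  unfold centredSum
  fun_prop

lemma centredSum_sub {f g : E → ℝ} (hf : ∀ i, Integrable f (μ i)) (hg : ∀ i, Integrable g (μ i))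
    (x : ι → E) : centredSum μ (f - g) x = centredSum μ f x - centredSum μ g x := by
  simp only [centredSum, ← Finset.sum_sub_distrib, Pi.sub_apply]
  refine Finset.sum_congr rfl fun i _ => ?_
  rw [integral_sub (hf i) (hg i)]
  ring

variable [∀ i, IsProbabilityMeasure (μ i)]

lemma integrable_centredSum {f : E → ℝ} (hf : ∀ i, Integrable f (μ i)) :
    Integrable (centredSum μ f) (Measure.pi μ) :=
  integrable_finsetSum _ fun i _ => (integrable_comp_eval (hf i)).sub (integrable_const _)

/-- The `L¹` norm of a centred sum of independent variables is at most the root of the sum of the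
variances. -/
lemma integral_abs_centredSum_le_sqrt {f : E → ℝ} (hf : ∀ i, MemLp f 2 (μ i)) :
    ∫ x, |centredSum μ f x| ∂(Measure.pi μ) ≤ √(∑ i, ∫ y, f y ^ 2 ∂(μ i)) := by
  have h2 : ∀ i, MemLp (fun x : ι → E => f (x i)) 2 (Measure.pi μ) := fun i =>
    (hf i).comp_measurePreserving (measurePreserving_eval μ i)
  have hm : MemLp (centredSum μ f) 2 (Measure.pi μ) :=
    memLp_finsetSum _ fun i _ => (h2 i).sub (memLp_const _)
  have hmean : ∫ x, (∑ i, fun x : ι → E => f (x i)) x ∂(Measure.pi μ)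
      = ∑ i, ∫ y, f y ∂(μ i) := by
    simp only [Finset.sum_apply]
    rw [integral_finsetSum _ fun i _ => (h2 i).integrable one_le_two]
    exact Finset.sum_congr rfl fun i _ => integral_comp_eval (hf i).1
  have hvar : ∫ x, centredSum μ f x ^ 2 ∂(Measure.pi μ) = ∑ i, Var[f; μ i] := by
    rw [← variance_sum_pi (μ := μ) (X := fun _ => f) hf, variance_eq_integral, hmean]
    · simp [centredSum, Finset.sum_sub_distrib]
    · exact Finset.aemeasurable_sum _ fun i _ => (h2 i).1.aemeasurable
  have hle : ∑ i, Var[f; μ i] ≤ ∑ i, ∫ y, f y ^ 2 ∂(μ i) :=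
    Finset.sum_le_sum fun i _ => variance_le_expectation_sq (hf i).1
  refine (Real.le_sqrt (integral_nonneg fun x => abs_nonneg _) ?_).2 ?_
  · exact Finset.sum_nonneg fun i _ => integral_nonneg fun _ => sq_nonneg _
  · refine le_trans ?_ (hvar.le.trans hle)
    have h := variance_nonneg (fun x => |centredSum μ f x|) (Measure.pi μ)
    have h3 : MemLp (fun x => |centredSum μ f x|) 2 (Measure.pi μ) := hm.abs
    rw [variance_eq_sub h3] at h
    simpa using h

/-- The characteristic function of a centred sum of bounded independent variables is close to the
Gaussian one. -/
lemma norm_integral_cexp_centredSum_sub_le_of_bounded {g : E → ℝ} (hm : Measurable g) {K : ℝ}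
    (hK : ∀ x, |g x| ≤ K) (a : ℝ) :
    ‖∫ x, Complex.exp (Complex.I * ((a * centredSum μ g x : ℝ) : ℂ)) ∂(Measure.pi μ)
        - (Real.exp (-(a ^ 2 / 2 * ∑ i, Var[g; μ i])) : ℂ)‖
      ≤ Fintype.card ι * ((|a| * (2 * K)) ^ 3 * Real.exp (|a| * (2 * K)) + (|a| * (2 * K)) ^ 4) := by
  have hprod : ∀ x : ι → E, Complex.exp (Complex.I * ((a * centredSum μ g x : ℝ) : ℂ))
      = ∏ i, Complex.exp (Complex.I * ((a * (g (x i) - ∫ y, g y ∂(μ i)) : ℝ) : ℂ)) := by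
    intro x
    rw [← Complex.exp_sum, centredSum]
    push_cast
    rw [Finset.mul_sum, Finset.mul_sum]
  have hexp : (Real.exp (-(a ^ 2 / 2 * ∑ i, Var[g; μ i])) : ℂ)
      = ∏ i, (Real.exp (-(a ^ 2 / 2 * Var[g; μ i])) : ℂ) := by
    rw [← Complex.ofReal_prod, ← Real.exp_sum, Finset.sum_neg_distrib, Finset.mul_sum]
  simp_rw [hprod]
  rw [integral_fintype_prod_eq_prod
    (f := fun i y => Complex.exp (Complex.I * ((a * (g y - ∫ y, g y ∂(μ i)) : ℝ) : ℂ))), hexp]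
  refine (norm_prod_sub_prod_le_sum _ _ _ (fun i => ?_) fun i => ?_).trans ?_
  · refine (norm_integral_le_of_norm_le_const (C := 1)
      (.of_forall fun x => (Complex.norm_exp_I_mul_ofReal _).le)).trans (by simp)
  · rw [Complex.norm_real, Real.norm_of_nonneg (Real.exp_pos _).le, Real.exp_le_one_iff]
    have := variance_nonneg g (μ i)
    simp only [Left.neg_nonpos_iff]
    positivity
  · rw [← nsmul_eq_mul]
    refine Finset.sum_le_card_nsmul _ _ _ fun i _ => ?_
    have ig : Integrable g (μ i) := .of_bound hm.aestronglyMeasurable K (.of_forall hK)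
    have hb : |∫ y, g y ∂(μ i)| ≤ K := by
      simpa using norm_integral_le_of_norm_le_const (μ := μ i) (f := g) (C := K) (.of_forall hK)
    have := norm_integral_cexp_sub_le (μ := μ i) (h := fun x => g x - ∫ y, g y ∂(μ i)) (K := 2 * K)
      (hm.sub_const _) (fun x => (abs_sub _ _).trans (by linarith [hK x]))
      (by rw [integral_sub ig (integrable_const _)]; simp) a
    rwa [← variance_eq_integral hm.aemeasurable] at this

/-- The characteristic function of a centred sum of square-integrable independent variables,
compared with the Gaussian one through an approximation by a bounded function. -/
lemma norm_integral_cexp_centredSum_sub_le {f g : E → ℝ} (hf : Measurable f)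
    (hf2 : ∀ i, MemLp f 2 (μ i)) (hm : Measurable g) {K : ℝ} (hK : ∀ x, |g x| ≤ K) (a : ℝ) {η : ℝ}
    (hη : 0 < η) :
    ‖∫ x, Complex.exp (Complex.I * ((a * centredSum μ f x : ℝ) : ℂ)) ∂(Measure.pi μ)
        - (Real.exp (-(a ^ 2 / 2 * ∑ i, Var[f; μ i])) : ℂ)‖
      ≤ Fintype.card ι * ((|a| * (2 * K)) ^ 3 * Real.exp (|a| * (2 * K)) + (|a| * (2 * K)) ^ 4)
        + |a| * √(∑ i, ∫ y, (f y - g y) ^ 2 ∂(μ i))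
        + a ^ 2 / 2 * (η * ∑ i, ∫ y, f y ^ 2 ∂(μ i)
            + (1 + 1 / η) * ∑ i, ∫ y, (f y - g y) ^ 2 ∂(μ i)) := by
  have hg2 : ∀ i, MemLp g 2 (μ i) := fun i =>
    .of_bound hm.aestronglyMeasurable K (.of_forall hK)
  have i1 : ∀ {h : E → ℝ}, Measurable h → Integrable
      (fun x => Complex.exp (Complex.I * ((a * centredSum μ h x : ℝ) : ℂ))) (Measure.pi μ) := by
    intro h hh
    have := measurable_centredSum (μ := μ) hh
    exact .of_bound (by fun_prop) 1 (.of_forall fun x => (Complex.norm_exp_I_mul_ofReal _).le)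
  have s1 : ‖∫ x, Complex.exp (Complex.I * ((a * centredSum μ f x : ℝ) : ℂ)) ∂(Measure.pi μ)
      - ∫ x, Complex.exp (Complex.I * ((a * centredSum μ g x : ℝ) : ℂ)) ∂(Measure.pi μ)‖
      ≤ |a| * √(∑ i, ∫ y, (f y - g y) ^ 2 ∂(μ i)) := by
    rw [← integral_sub (i1 hf) (i1 hm)]
    have hfg : ∀ i, MemLp (f - g) 2 (μ i) := fun i => (hf2 i).sub (hg2 i)
    refine (norm_integral_le_of_norm_le (g := fun x => |a| * |centredSum μ (f - g) x|)
      ((integrable_centredSum fun i => (hfg i).integrable one_le_two).abs.const_mul _)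
      (.of_forall fun x => ?_)).trans ?_
    · refine (norm_cexp_I_mul_sub_le _ _).trans ?_
      rw [centredSum_sub (fun i => (hf2 i).integrable one_le_two)
        (fun i => (hg2 i).integrable one_le_two), ← mul_sub, abs_mul]
    · rw [integral_const_mul]
      gcongr
      exact integral_abs_centredSum_le_sqrt hfg
  have s2 := norm_integral_cexp_centredSum_sub_le_of_bounded (μ := μ) hm hK a
  have s3 : ‖(Real.exp (-(a ^ 2 / 2 * ∑ i, Var[g; μ i])) : ℂ)
      - (Real.exp (-(a ^ 2 / 2 * ∑ i, Var[f; μ i])) : ℂ)‖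
      ≤ a ^ 2 / 2 * (η * ∑ i, ∫ y, f y ^ 2 ∂(μ i)
            + (1 + 1 / η) * ∑ i, ∫ y, (f y - g y) ^ 2 ∂(μ i)) := by
    have n1 : ∀ h : E → ℝ, 0 ≤ ∑ i, Var[h; μ i] := fun h =>
      Finset.sum_nonneg fun i _ => variance_nonneg _ _
    rw [← Complex.ofReal_sub, Complex.norm_real, Real.norm_eq_abs]
    have := n1 f
    have := n1 g
    refine (abs_exp_neg_sub_exp_neg_le (by positivity) (by positivity)).trans ?_
    rw [← mul_sub, abs_mul, abs_of_nonneg (by positivity : 0 ≤ a ^ 2 / 2), abs_sub_comm,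
      ← Finset.sum_sub_distrib, Finset.mul_sum, Finset.mul_sum, ← Finset.sum_add_distrib]
    gcongr
    exact (Finset.abs_sum_le_sum_abs _ _).trans
      (Finset.sum_le_sum fun i _ => abs_variance_sub_variance_le (hf2 i) (hg2 i) hη)
  set A := ∫ x, Complex.exp (Complex.I * ((a * centredSum μ f x : ℝ) : ℂ)) ∂(Measure.pi μ)
  set B := ∫ x, Complex.exp (Complex.I * ((a * centredSum μ g x : ℝ) : ℂ)) ∂(Measure.pi μ)
  set G := (Real.exp (-(a ^ 2 / 2 * ∑ i, Var[g; μ i])) : ℂ)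
  set F := (Real.exp (-(a ^ 2 / 2 * ∑ i, Var[f; μ i])) : ℂ)
  calc ‖A - F‖ = ‖(A - B) + (B - G) + (G - F)‖ := by congr 1; ring
    _ ≤ ‖A - B‖ + ‖B - G‖ + ‖G - F‖ := norm_add₃_le
    _ ≤ _ := by linarith

/-- The `L¹` norm of a centred sum of integrable independent variables, estimated through an
approximation by a bounded function. -/
lemma integral_abs_centredSum_le {f g : E → ℝ} (hf : ∀ i, Integrable f (μ i)) (hm : Measurable g)
    {K : ℝ} (hK : ∀ x, |g x| ≤ K) :
    ∫ x, |centredSum μ f x| ∂(Measure.pi μ)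
      ≤ √(Fintype.card ι * K ^ 2) + 2 * ∑ i, ∫ y, |f y - g y| ∂(μ i) := by
  have hg2 : ∀ i, MemLp g 2 (μ i) := fun i =>
    .of_bound hm.aestronglyMeasurable K (.of_forall hK)
  have hg : ∀ i, Integrable g (μ i) := fun i => (hg2 i).integrable one_le_two
  have hfg : ∀ i, Integrable (f - g) (μ i) := fun i => (hf i).sub (hg i)
  have s1 : ∫ x, |centredSum μ g x| ∂(Measure.pi μ) ≤ √(Fintype.card ι * K ^ 2) := by
    refine (integral_abs_centredSum_le_sqrt hg2).trans (Real.sqrt_le_sqrt ?_)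
    rw [← nsmul_eq_mul]
    refine Finset.sum_le_card_nsmul _ _ _ fun i _ => ?_
    have := integral_mono (hg2 i).integrable_sq (integrable_const (K ^ 2))
      fun x => sq_le_sq.2 ((hK x).trans (le_abs_self K))
    simpa using this
  have s2 : ∫ x, |centredSum μ (f - g) x| ∂(Measure.pi μ)
      ≤ 2 * ∑ i, ∫ y, |f y - g y| ∂(μ i) := by
    have ii : ∀ i, Integrable (fun x : ι → E => |(f - g) (x i)| + ∫ y, |f y - g y| ∂(μ i))
        (Measure.pi μ) := fun i => (integrable_comp_eval (hfg i)).abs.add (integrable_const _)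
    calc _ ≤ ∫ x : ι → E, ∑ i, (|(f - g) (x i)| + ∫ y, |f y - g y| ∂(μ i)) ∂(Measure.pi μ) := by
          refine integral_mono (integrable_centredSum hfg).abs
            (integrable_finsetSum _ fun i _ => ii i) fun x => ?_
          refine (Finset.abs_sum_le_sum_abs _ _).trans (Finset.sum_le_sum fun i _ => ?_)
          exact (abs_sub _ _).trans (add_le_add_right (abs_integral_le_integral_abs) _)
      _ = _ := by
          rw [integral_finsetSum _ fun i _ => ii i, Finset.mul_sum]
          refine Finset.sum_congr rfl fun i _ => ?_
          rw [integral_add (integrable_comp_eval (hfg i)).abs (integrable_const _),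
            integral_comp_eval (μ := μ) (i := i) (f := fun y => |(f - g) y|) (hfg i).abs.1]
          simp
          ring
  calc _ ≤ ∫ x, (|centredSum μ g x| + |centredSum μ (f - g) x|) ∂(Measure.pi μ) := by
        refine integral_mono (integrable_centredSum hf).abs
          ((integrable_centredSum hg).abs.add (integrable_centredSum hfg).abs) fun x => ?_
        have : centredSum μ f x = centredSum μ g x + centredSum μ (f - g) x := by
          rw [centredSum_sub hf hg]; ring
        simp only [this]
        exact abs_add_le _ _
    _ ≤ _ := by
        rw [integral_add (integrable_centredSum hg).abs (integrable_centredSum hfg).abs]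
        exact add_le_add s1 s2

end Product

/-! ### Convergence in probability -/

section InMeasure

variable {Ω : Type*} [MeasurableSpace Ω] {P : Measure Ω}

/-- Bounded convergence theorem for convergence in probability. -/
lemma tendsto_integral_of_tendstoInMeasure [IsProbabilityMeasure P] {F : Type*}
    [NormedAddCommGroup F] [NormedSpace ℝ F]
    {X : ℕ → Ω → F} {Y : Ω → F} (h : TendstoInMeasure P X atTop Y) {K : ℝ}
    (hK : ∀ n ω, ‖X n ω‖ ≤ K) (hX : ∀ n, AEStronglyMeasurable (X n) P) :
    Tendsto (fun n => ∫ ω, X n ω ∂P) atTop (𝓝 (∫ ω, Y ω ∂P)) := by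
  refine tendsto_of_subseq_tendsto fun ns hns => ?_
  obtain ⟨ms, -, hms⟩ := (h.comp hns).exists_seq_tendsto_ae
  exact ⟨ms, tendsto_integral_of_dominated_convergence (fun _ => K) (fun n => hX _)
    (integrable_const _) (fun n => .of_forall fun ω => hK _ ω) hms⟩

/-- Continuous mapping theorem for convergence in probability to a constant. -/
lemma tendstoInMeasure_comp_prodMk {E₁ E₂ F : Type*} [PseudoMetricSpace E₁]
    [PseudoMetricSpace E₂] [PseudoMetricSpace F] {X : ℕ → Ω → E₁} {Y : ℕ → Ω → E₂} {a : E₁} {b : E₂}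
    {g : E₁ × E₂ → F} (hg : ContinuousAt g (a, b))
    (hX : TendstoInMeasure P X atTop fun _ => a) (hY : TendstoInMeasure P Y atTop fun _ => b) :
    TendstoInMeasure P (fun n ω => g (X n ω, Y n ω)) atTop fun _ => g (a, b) := by
  rw [tendstoInMeasure_iff_dist] at hX hY ⊢
  intro ε hε
  obtain ⟨δ, hδ, h⟩ := Metric.continuousAt_iff.1 hg ε hε
  have hs := (hX δ hδ).add (hY δ hδ)
  rw [add_zero] at hs
  refine tendsto_of_tendsto_of_tendsto_of_le_of_le tendsto_const_nhds hs
    (fun _ => zero_le) fun n => ?_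
  refine (measure_mono fun ω hω => ?_).trans (measure_union_le _ _)
  by_contra hc
  simp only [Set.mem_union, Set.mem_ofPred_eq, not_or, not_le] at hc
  have := h (x := (X n ω, Y n ω)) (by rw [Prod.dist_eq]; exact max_lt hc.1 hc.2)
  exact absurd hω (not_le.2 this)

lemma tendstoInMeasure_comp {E₁ F : Type*} [PseudoMetricSpace E₁]
    [PseudoMetricSpace F] {X : ℕ → Ω → E₁} {a : E₁}
    {g : E₁ → F} (hg : ContinuousAt g a) (hX : TendstoInMeasure P X atTop fun _ => a) :
    TendstoInMeasure P (fun n ω => g (X n ω)) atTop fun _ => g a :=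
  tendstoInMeasure_comp_prodMk (g := fun x : E₁ × E₁ => g x.1) (b := a)
    (ContinuousAt.comp (f := Prod.fst) hg continuousAt_fst) hX hX

lemma tendstoInMeasure_of_tendsto_const {F : Type*} [PseudoMetricSpace F] {c : ℕ → F} {a : F}
    (h : Tendsto c atTop (𝓝 a)) : TendstoInMeasure P (fun n _ => c n) atTop fun _ => a := by
  rw [tendstoInMeasure_iff_dist]
  intro ε hε
  refine tendsto_const_nhds.congr' ?_
  filter_upwards [Metric.tendsto_nhds.1 h ε hε] with n hn
  have he : {_x : Ω | ε ≤ dist (c n) a} = ∅ :=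
    Set.eq_empty_of_forall_notMem fun _ h => absurd h (not_le.2 hn)
  rw [he, measure_empty]

/-- A sequence tends to zero in probability if, for each `ε`, its norms are eventually dominated by
a sequence that tends in probability to a constant smaller than `ε`. -/
lemma tendstoInMeasure_zero_of_forall_dominated {F : Type*} [SeminormedAddCommGroup F]
    {D : ℕ → Ω → F}
    (h : ∀ ε > 0, ∃ (R : ℕ → Ω → ℝ) (l : ℝ), l < ε ∧ TendstoInMeasure P R atTop (fun _ => l) ∧
      ∀ᶠ n in atTop, ∀ᵐ ω ∂P, ‖D n ω‖ ≤ R n ω) :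
    TendstoInMeasure P D atTop fun _ => 0 := by
  rw [tendstoInMeasure_iff_norm]
  intro ε hε
  obtain ⟨R, l, hl, hR, hD⟩ := h ε hε
  have := tendstoInMeasure_iff_norm.1 hR (ε - l) (by linarith)
  refine tendsto_of_tendsto_of_tendsto_of_le_of_le' tendsto_const_nhds this
    (.of_forall fun _ => zero_le) ?_
  filter_upwards [hD] with n hn
  refine measure_mono_ae ?_
  filter_upwards [hn] with ω hω
  intro (h1 : ε ≤ ‖D n ω - 0‖)
  rw [sub_zero] at h1
  exact (show ε - l ≤ ‖R n ω - l‖ from (by linarith [le_abs_self (R n ω - l)] :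
    ε - l ≤ |R n ω - l|))

end InMeasure

section Approximation

variable {E : Type*} [MeasurableSpace E] {ν : Measure E}

/-- Bounded measurable functions are dense in `L¹`. -/
lemma exists_bounded_integral_abs_sub_lt {f : E → ℝ} (hf : Integrable f ν) {δ : ℝ} (hδ : 0 < δ) :
    ∃ (g : E → ℝ) (K : ℝ), Measurable g ∧ (∀ x, |g x| ≤ K) ∧ Integrable g ν ∧
      ∫ x, |f x - g x| ∂ν < δ := by
  obtain ⟨g, hg, hgi⟩ := (memLp_one_iff_integrable.2 hf).exists_simpleFunc_eLpNorm_sub_lt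
    ENNReal.one_ne_top (ε := ENNReal.ofReal δ) (by simpa using hδ)
  obtain ⟨K, hK⟩ := g.exists_forall_norm_le
  refine ⟨g, K, g.measurable, hK, memLp_one_iff_integrable.1 hgi, ?_⟩
  rw [eLpNorm_one_eq_lintegral_enorm] at hg
  have := integral_norm_eq_lintegral_enorm (μ := ν) (f := f - (g : E → ℝ))
    (hf.1.sub g.measurable.aestronglyMeasurable)
  simp only [Real.norm_eq_abs, Pi.sub_apply] at this hg
  rw [this]
  exact (ENNReal.toReal_lt_of_lt_ofReal hg)

/-- Bounded measurable functions are dense in `L²`. -/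
lemma exists_bounded_integral_sq_sub_lt {f : E → ℝ} (hf : MemLp f 2 ν) {δ : ℝ} (hδ : 0 < δ) :
    ∃ (g : E → ℝ) (K : ℝ), Measurable g ∧ (∀ x, |g x| ≤ K) ∧ MemLp g 2 ν ∧
      ∫ x, (f x - g x) ^ 2 ∂ν < δ := by
  obtain ⟨g, hg, hgi⟩ := hf.exists_simpleFunc_eLpNorm_sub_lt
    ENNReal.ofNat_ne_top (ε := ENNReal.ofReal (√δ)) (by simpa using hδ)
  obtain ⟨K, hK⟩ := g.exists_forall_norm_le
  refine ⟨g, K, g.measurable, hK, hgi, ?_⟩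
  have hfg : MemLp (f - (g : E → ℝ)) 2 ν := hf.sub hgi
  have h1 := hfg.eLpNorm_eq_integral_rpow_norm (by norm_num) (by norm_num)
  rw [h1, ENNReal.ofReal_lt_ofReal_iff (by positivity)] at hg
  simp only [ENNReal.toReal_ofNat, Real.rpow_two, Pi.sub_apply, Real.norm_eq_abs, sq_abs] at hg
  rw [← one_div, ← Real.sqrt_eq_rpow] at hg
  exact (Real.sqrt_lt_sqrt_iff (integral_nonneg fun x => sq_nonneg _)).1 hg

end Approximation

/-! ### Conditionally independent triangular arrays -/

section PiKernel

variable {ι Y E : Type*} [Fintype ι] [MeasurableSpace Y] [MeasurableSpace E]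

/-- The product of finitely many Markov kernels with the same source. -/
def piKernel (κ : ι → Kernel Y E) [∀ i, IsMarkovKernel (κ i)] : Kernel Y (ι → E) where
  toFun y := Measure.pi fun i => κ i y
  measurable' := by
    refine Measurable.measure_of_isPiSystem_of_isProbabilityMeasure generateFrom_pi.symm
      isPiSystem_pi ?_
    rintro _ ⟨s, hs, rfl⟩
    simp only [Measure.pi_pi]
    exact Finset.measurable_fun_prod _ fun i _ => Kernel.measurable_coe _ (hs i trivial)

lemma piKernel_apply (κ : ι → Kernel Y E) [∀ i, IsMarkovKernel (κ i)] (y : Y) :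
    piKernel κ y = Measure.pi fun i => κ i y := rfl

instance (κ : ι → Kernel Y E) [∀ i, IsMarkovKernel (κ i)] : IsMarkovKernel (piKernel κ) :=
  ⟨fun y => by rw [piKernel_apply]; infer_instance⟩

end PiKernel

variable {Ω E : Type*} [MeasurableSpace Ω] [MeasurableSpace E] {𝒴 : ℕ → Type*}
  [∀ H, MeasurableSpace (𝒴 H)]

/-- The average over `j` of the conditional means `∫ f dκ_j` in row `H`, as a function of the
conditioning variable. -/
def condAvg (κ : ∀ H, Fin H → Kernel (𝒴 H) E) (f : E → ℝ) (H : ℕ) (y : 𝒴 H) : ℝ :=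
  (∑ j, ∫ x, f x ∂(κ H j y)) / H

/-- The average over `j` of the conditional variances in row `H`. -/
def condVarAvg (κ : ∀ H, Fin H → Kernel (𝒴 H) E) (f : E → ℝ) (H : ℕ) (y : 𝒴 H) : ℝ :=
  (∑ j, Var[f; κ H j y]) / H

/-- A triangular array `X` whose row `H` consists, given the random variable `Y H`, of `H`
independent entries, the `j`-th one with law `κ H j (Y H)`. The averages of these laws converge to
`ν` in the sense that `condAvg` satisfies a weak law of large numbers for every `f ∈ L¹(ν)`. The
integrability condition is stated for functions with values in `[0, ∞]`, so that it also covers the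
null sets of `ν`. -/
structure IsCondIndepArray (P : Measure Ω) (ν : Measure E) (Y : ∀ H, Ω → 𝒴 H)
    (X : ∀ H, Ω → Fin H → E) (κ : ∀ H, Fin H → Kernel (𝒴 H) E) [∀ H j, IsMarkovKernel (κ H j)] :
    Prop where
  measurable_cond : ∀ H, Measurable (Y H)
  measurable_array : ∀ H, Measurable (X H)
  map_eq : ∀ H, P.map (fun ω => (Y H ω, X H ω)) = (P.map (Y H)) ⊗ₘ piKernel (κ H)
  lintegral_ne_top : ∀ f : E → ENNReal, Measurable f → ∫⁻ x, f x ∂ν ≠ ⊤ →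
    ∀ H, ∀ᵐ ω ∂P, ∀ j, ∫⁻ x, f x ∂(κ H j (Y H ω)) ≠ ⊤
  tendsto_condAvg : ∀ f : E → ℝ, Measurable f → Integrable f ν →
    TendstoInMeasure P (fun H ω => condAvg κ f H (Y H ω)) atTop fun _ => ∫ x, f x ∂ν

section Measurability

variable {κ : ∀ H, Fin H → Kernel (𝒴 H) E}

lemma measurable_condAvg {f : E → ℝ} (hf : Measurable f) (H : ℕ) : Measurable (condAvg κ f H) :=
  (Finset.measurable_fun_sum _ fun _ _ =>
    hf.stronglyMeasurable.integral_kernel.measurable).div_const _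

lemma measurable_centredSum_kernel {f : E → ℝ} (hf : Measurable f) (H : ℕ) :
    Measurable fun p : 𝒴 H × (Fin H → E) => centredSum (fun j => κ H j p.1) f p.2 := by
  refine Finset.measurable_fun_sum _ fun j _ => ?_
  exact (hf.comp ((measurable_pi_apply j).comp measurable_snd)).sub
    (hf.stronglyMeasurable.integral_kernel.measurable.comp measurable_fst)

lemma sum_sub_condAvg (f : E → ℝ) (H : ℕ) (y : 𝒴 H) (x : Fin H → E) :
    (∑ j, f (x j)) / H - condAvg κ f H y = centredSum (fun j => κ H j y) f x / H := by
  rw [condAvg, centredSum, Finset.sum_sub_distrib, sub_div]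

end Measurability

namespace IsCondIndepArray

variable {P : Measure Ω} {ν : Measure E} {Y : ∀ H, Ω → 𝒴 H}
  {X : ∀ H, Ω → Fin H → E} {κ : ∀ H, Fin H → Kernel (𝒴 H) E} [∀ H j, IsMarkovKernel (κ H j)]

/-- The integrability of a single function transfers to the random measures `κ H j (Y H)`. -/
lemma ae_integrable (h : IsCondIndepArray P ν Y X κ) {f : E → ℝ} (hf : Measurable f)
    (hi : Integrable f ν) (H : ℕ) : ∀ᵐ ω ∂P, ∀ j, Integrable f (κ H j (Y H ω)) := by
  filter_upwards [h.lintegral_ne_top (fun x => ‖f x‖ₑ) hf.enorm hi.2.ne H] with ω hω j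
  exact ⟨hf.aestronglyMeasurable, (hω j).lt_top⟩

lemma ae_memLp_two (h : IsCondIndepArray P ν Y X κ) {f : E → ℝ} (hf : Measurable f)
    (hi : MemLp f 2 ν) (H : ℕ) : ∀ᵐ ω ∂P, ∀ j, MemLp f 2 (κ H j (Y H ω)) := by
  filter_upwards [h.ae_integrable (hf.pow_const 2) hi.integrable_sq H] with ω hω j
  exact (memLp_two_iff_integrable_sq hf.aestronglyMeasurable).2 (hω j)

/-- The conditional characteristic functions of the normalised centred sums are asymptotically
Gaussian. -/
lemma tendstoInMeasure_cexp_centredSum (h : IsCondIndepArray P ν Y X κ) {f : E → ℝ}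
    (hf : Measurable f) (hi : MemLp f 2 ν) {v : ℝ}
    (hv : TendstoInMeasure P (fun H ω => condVarAvg κ f H (Y H ω)) atTop fun _ => v) (u : ℝ) :
    TendstoInMeasure P (fun H ω => ∫ x, Complex.exp (Complex.I *
        ((u / √(H : ℝ) * centredSum (fun j => κ H j (Y H ω)) f x : ℝ) : ℂ))
          ∂(Measure.pi fun j => κ H j (Y H ω)))
      atTop fun _ => (Real.exp (-(u ^ 2 / 2 * v)) : ℂ) := by
  have h1 : TendstoInMeasure P
      (fun H ω => (Real.exp (-(u ^ 2 / 2 * condVarAvg κ f H (Y H ω))) : ℂ)) atTop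
      fun _ => (Real.exp (-(u ^ 2 / 2 * v)) : ℂ) :=
    tendstoInMeasure_comp (g := fun w : ℝ => (Real.exp (-(u ^ 2 / 2 * w)) : ℂ)) (by fun_prop) hv
  suffices hD : TendstoInMeasure P (fun H ω => ∫ x, Complex.exp (Complex.I *
        ((u / √(H : ℝ) * centredSum (fun j => κ H j (Y H ω)) f x : ℝ) : ℂ))
          ∂(Measure.pi fun j => κ H j (Y H ω))
        - (Real.exp (-(u ^ 2 / 2 * condVarAvg κ f H (Y H ω))) : ℂ)) atTop fun _ => (0 : ℂ) by
    have := tendstoInMeasure_comp_prodMk (g := fun p : ℂ × ℂ => p.1 + p.2)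
      (by fun_prop) hD h1
    simpa using this
  refine tendstoInMeasure_zero_of_forall_dominated fun ε hε => ?_
  set q := ∫ x, f x ^ 2 ∂ν with hq
  have hq0 : 0 ≤ q := integral_nonneg fun x => sq_nonneg _
  -- `η` and then the approximation `g` of `f` make the two error terms smaller than `ε`.
  obtain ⟨η, hη, hηε⟩ : ∃ η > 0, u ^ 2 / 2 * (η * q) < ε := by
    refine ⟨ε / (u ^ 2 / 2 * q + 1), by positivity, ?_⟩
    rw [← mul_assoc, mul_comm (u ^ 2 / 2), mul_assoc, div_mul_eq_mul_div,
      div_lt_iff₀ (by positivity)]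
    nlinarith
  obtain ⟨δ, hδ, hδε⟩ : ∃ δ > 0, ∀ r, 0 ≤ r → r < δ →
      |u| * √r + u ^ 2 / 2 * (η * q + (1 + 1 / η) * r) < ε := by
    have hc : ContinuousAt (fun r => |u| * √r + u ^ 2 / 2 * (η * q + (1 + 1 / η) * r)) 0 := by
      fun_prop
    have := hc.eventually_lt (continuousAt_const (y := ε)) (by simpa using hηε)
    obtain ⟨δ, hδ, h⟩ := Metric.eventually_nhds_iff.1 this
    exact ⟨δ, hδ, fun r hr hr' => h (by rwa [Real.dist_eq, sub_zero, abs_of_nonneg hr])⟩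
  obtain ⟨g, K, hg, hK, hgi, hfg⟩ := exists_bounded_integral_sq_sub_lt hi hδ
  set r := ∫ x, (f x - g x) ^ 2 ∂ν with hr
  have hr0 : 0 ≤ r := integral_nonneg fun x => sq_nonneg _
  -- The error for bounded functions is of order `H * H ^ (-3 / 2)`.
  have hcK : Tendsto (fun H : ℕ => (H : ℝ) * ((|u / √(H : ℝ)| * (2 * K)) ^ 3
      * Real.exp (|u / √(H : ℝ)| * (2 * K)) + (|u / √(H : ℝ)| * (2 * K)) ^ 4)) atTop (𝓝 0) := by
    have hs : Tendsto (fun H : ℕ => 1 / √(H : ℝ)) atTop (𝓝 0) :=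
      tendsto_const_nhds.div_atTop (Real.tendsto_sqrt_atTop.comp tendsto_natCast_atTop_atTop)
    have hc : Tendsto (fun w : ℝ => (|u| * (2 * K)) ^ 3 * w * Real.exp (w * (|u| * (2 * K)))
        + (|u| * (2 * K)) ^ 4 * w ^ 2) (𝓝 0) (𝓝 0) := by
      have : Continuous fun w : ℝ => (|u| * (2 * K)) ^ 3 * w * Real.exp (w * (|u| * (2 * K)))
        + (|u| * (2 * K)) ^ 4 * w ^ 2 := by fun_prop
      simpa using this.tendsto 0
    refine (hc.comp hs).congr' ?_
    filter_upwards [eventually_gt_atTop 0] with H hH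
    have hH' : (0 : ℝ) < H := Nat.cast_pos.2 hH
    have hH'' : (H : ℝ) = √(H : ℝ) ^ 2 := (Real.sq_sqrt hH'.le).symm
    have h0 : 0 < √(H : ℝ) := Real.sqrt_pos.2 hH'
    simp only [Function.comp_apply]
    rw [abs_div, abs_of_pos h0]
    have e : 1 / √(H : ℝ) * (|u| * (2 * K)) = |u| / √(H : ℝ) * (2 * K) := by ring
    rw [e]
    nth_rewrite 4 [hH'']
    field_simp
  have hr_lim := h.tendsto_condAvg (fun x => (f x - g x) ^ 2) ((hf.sub hg).pow_const 2)
    (hi.sub hgi).integrable_sq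
  have hq_lim := h.tendsto_condAvg (fun x => f x ^ 2) (hf.pow_const 2) hi.integrable_sq
  refine ⟨fun H ω => (H : ℝ) * ((|u / √(H : ℝ)| * (2 * K)) ^ 3
      * Real.exp (|u / √(H : ℝ)| * (2 * K)) + (|u / √(H : ℝ)| * (2 * K)) ^ 4)
      + (|u| * √(condAvg κ (fun x => (f x - g x) ^ 2) H (Y H ω))
        + u ^ 2 / 2 * (η * condAvg κ (fun x => f x ^ 2) H (Y H ω)
          + (1 + 1 / η) * condAvg κ (fun x => (f x - g x) ^ 2) H (Y H ω))),
    0 + (|u| * √r + u ^ 2 / 2 * (η * q + (1 + 1 / η) * r)), ?_, ?_, ?_⟩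
  · rw [zero_add]; exact hδε r hr0 hfg
  · refine tendstoInMeasure_comp_prodMk (g := fun p : ℝ × ℝ => p.1 + p.2)
      (by fun_prop) (tendstoInMeasure_of_tendsto_const hcK) ?_
    exact tendstoInMeasure_comp_prodMk (g := fun p : ℝ × ℝ => |u| * √p.1
        + u ^ 2 / 2 * (η * p.2 + (1 + 1 / η) * p.1)) (by fun_prop) hr_lim hq_lim
  · filter_upwards [eventually_gt_atTop 0] with H hH
    filter_upwards [h.ae_memLp_two hf hi H] with ω hω
    have hH' : (0 : ℝ) < H := Nat.cast_pos.2 hH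
    have key := norm_integral_cexp_centredSum_sub_le hf hω hg hK (u / √(H : ℝ)) hη
    have ha2 : (u / √(H : ℝ)) ^ 2 = u ^ 2 / H := by rw [div_pow, Real.sq_sqrt hH'.le]
    rw [ha2, Fintype.card_fin] at key
    have e1 : u ^ 2 / H / 2 * ∑ j, Var[f; κ H j (Y H ω)]
        = u ^ 2 / 2 * condVarAvg κ f H (Y H ω) := by rw [condVarAvg]; ring
    have e2 : |u / √(H : ℝ)| * √(∑ j, ∫ y, (f y - g y) ^ 2 ∂(κ H j (Y H ω)))
        = |u| * √(condAvg κ (fun x => (f x - g x) ^ 2) H (Y H ω)) := by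
      rw [condAvg, Real.sqrt_div' _ hH'.le, abs_div, abs_of_nonneg (Real.sqrt_nonneg _)]
      ring
    have e3 : u ^ 2 / H / 2 * (η * ∑ j, ∫ y, f y ^ 2 ∂(κ H j (Y H ω))
          + (1 + 1 / η) * ∑ j, ∫ y, (f y - g y) ^ 2 ∂(κ H j (Y H ω)))
        = u ^ 2 / 2 * (η * condAvg κ (fun x => f x ^ 2) H (Y H ω)
          + (1 + 1 / η) * condAvg κ (fun x => (f x - g x) ^ 2) H (Y H ω)) := by
      rw [condAvg, condAvg]; ring
    rw [e1, e2, e3, add_assoc] at key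
    exact key

variable [IsProbabilityMeasure P]

/-- Disintegration of bounded functions of the conditioning variable and the array. -/
lemma integral_comp_eq (h : IsCondIndepArray P ν Y X κ) (H : ℕ) {G : 𝒴 H × (Fin H → E) → ℂ}
    (hG : Measurable G) {K : ℝ} (hK : ∀ p, ‖G p‖ ≤ K) :
    ∫ ω, G (Y H ω, X H ω) ∂P
      = ∫ ω, ∫ x, G (Y H ω, x) ∂(Measure.pi fun j => κ H j (Y H ω)) ∂P := by
  have hm := (h.measurable_cond H).prodMk (h.measurable_array H)
  have : IsProbabilityMeasure (P.map (Y H)) :=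
    Measure.isProbabilityMeasure_map (h.measurable_cond H).aemeasurable
  have hi : Integrable G ((P.map (Y H)) ⊗ₘ piKernel (κ H)) :=
    .of_bound hG.aestronglyMeasurable K (.of_forall hK)
  rw [← integral_map (f := G) hm.aemeasurable hG.aestronglyMeasurable, h.map_eq H,
    Measure.integral_compProd hi,
    integral_map (h.measurable_cond H).aemeasurable]
  · rfl
  · exact (hG.stronglyMeasurable.integral_kernel_prod_right'
      (κ := piKernel (κ H))).aestronglyMeasurable

lemma measure_eq_lintegral (h : IsCondIndepArray P ν Y X κ) (H : ℕ) {s : Set (𝒴 H × (Fin H → E))}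
    (hs : MeasurableSet s) :
    P {ω | (Y H ω, X H ω) ∈ s}
      = ∫⁻ ω, (Measure.pi fun j => κ H j (Y H ω)) {x | (Y H ω, x) ∈ s} ∂P := by
  have hm := (h.measurable_cond H).prodMk (h.measurable_array H)
  have : IsProbabilityMeasure (P.map (Y H)) :=
    Measure.isProbabilityMeasure_map (h.measurable_cond H).aemeasurable
  have := Measure.map_apply (μ := P) hm hs
  rw [h.map_eq H, Measure.compProd_apply hs,
    lintegral_map (Kernel.measurable_kernel_prodMk_left hs) (h.measurable_cond H)] at this
  exact this.symm

/-- The laws of the entries are absolutely continuous with respect to the limit measure. -/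
lemma map_absolutelyContinuous (h : IsCondIndepArray P ν Y X κ) (H : ℕ) (j : Fin H) :
    P.map (fun ω => X H ω j) ≪ ν := by
  refine Measure.AbsolutelyContinuous.mk fun s hs hs0 => ?_
  have hXj : Measurable fun ω => X H ω j := (measurable_pi_apply j).comp (h.measurable_array H)
  rw [Measure.map_apply hXj hs]
  have e := h.measure_eq_lintegral H (s := {p | p.2 j ∈ s})
    (hs.preimage ((measurable_pi_apply j).comp measurable_snd))
  refine Eq.trans e ?_
  refine (lintegral_congr_ae ?_).trans lintegral_zero
  -- The function `∞ · 1_s` has `ν`-integral zero, so it is integrable under the kernels.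
  have hnull := h.lintegral_ne_top (s.indicator fun _ => ⊤) (measurable_const.indicator hs)
    (by rw [lintegral_indicator_const hs, hs0]; simp) H
  filter_upwards [hnull] with ω hω
  have h2 := hω j
  rw [lintegral_indicator_const hs] at h2
  have h3 : κ H j (Y H ω) s = 0 := by
    by_contra hc
    exact h2 (ENNReal.top_mul hc)
  have := (measurePreserving_eval (fun j => κ H j (Y H ω)) j).measure_preimage hs.nullMeasurableSet
  exact this.trans h3

/-- The weak law of large numbers is passed on from the conditional means to the array. -/
theorem tendstoInMeasure_avg (h : IsCondIndepArray P ν Y X κ) {f : E → ℝ} (hf : Measurable f)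
    (hi : Integrable f ν) :
    TendstoInMeasure P (fun H ω => (∑ j, f (X H ω j)) / H) atTop fun _ => ∫ x, f x ∂ν := by
  suffices hD : TendstoInMeasure P
      (fun H ω => (∑ j, f (X H ω j)) / H - condAvg κ f H (Y H ω)) atTop fun _ => (0 : ℝ) by
    have := tendstoInMeasure_comp_prodMk (g := fun p : ℝ × ℝ => p.1 + p.2)
      (by fun_prop) hD (h.tendsto_condAvg f hf hi)
    simpa using this
  rw [tendstoInMeasure_iff_norm]
  intro ε hε
  set s : ∀ H, Set (𝒴 H × (Fin H → E)) := fun H =>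
    {p | ε ≤ ‖centredSum (fun j => κ H j p.1) f p.2 / H‖} with hs_def
  have hs : ∀ H, MeasurableSet (s H) := fun H =>
    measurableSet_le measurable_const ((measurable_centredSum_kernel hf H).div_const _).norm
  set p : ∀ H, 𝒴 H → ENNReal := fun H y => (Measure.pi fun j => κ H j y) {x | (y, x) ∈ s H}
    with hp_def
  have hpm : ∀ H, Measurable (p H) := fun H =>
    Kernel.measurable_kernel_prodMk_left (κ := piKernel (κ H)) (hs H)
  have hp1 : ∀ H y, p H y ≤ 1 := fun H y => prob_le_one
  -- The conditional probability of a large deviation tends to zero in probability.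
  have hp : TendstoInMeasure P (fun H ω => (p H (Y H ω)).toReal) atTop fun _ => (0 : ℝ) := by
    refine tendstoInMeasure_zero_of_forall_dominated fun δ hδ => ?_
    obtain ⟨g, K, hg, hK, hgi, hfg⟩ := exists_bounded_integral_abs_sub_lt hi
      (δ := δ * ε / 2) (by positivity)
    refine ⟨fun H ω => (√(H * K ^ 2) / H
        + 2 * condAvg κ (fun x => |f x - g x|) H (Y H ω)) / ε,
      (0 + 2 * ∫ x, |f x - g x| ∂ν) / ε, ?_, ?_, ?_⟩
    · rw [div_lt_iff₀ hε]; linarith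
    · refine tendstoInMeasure_comp_prodMk (g := fun q : ℝ × ℝ => (q.1 + 2 * q.2) / ε)
        (by fun_prop) (tendstoInMeasure_of_tendsto_const ?_)
        (h.tendsto_condAvg _ (hf.sub hg).abs (hi.sub hgi).abs)
      have : Tendsto (fun H : ℕ => √(K ^ 2) / √(H : ℝ)) atTop (𝓝 0) :=
        tendsto_const_nhds.div_atTop (Real.tendsto_sqrt_atTop.comp tendsto_natCast_atTop_atTop)
      refine this.congr fun H => ?_
      rw [Real.sqrt_mul (Nat.cast_nonneg _), mul_comm, mul_div_assoc, Real.sqrt_div_self',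
        mul_one_div]
    · filter_upwards [eventually_gt_atTop 0] with H hH
      filter_upwards [h.ae_integrable hf hi H] with ω hω
      have hH' : (0 : ℝ) < H := Nat.cast_pos.2 hH
      rw [Real.norm_of_nonneg ENNReal.toReal_nonneg, le_div_iff₀ hε]
      have hi' : Integrable (fun x => ‖centredSum (fun j => κ H j (Y H ω)) f x / H‖)
          (Measure.pi fun j => κ H j (Y H ω)) :=
        ((integrable_centredSum hω).div_const _).norm
      have m := mul_meas_ge_le_integral_of_nonneg (.of_forall fun x => norm_nonneg _) hi' ε
      rw [mul_comm]
      refine m.trans ?_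
      have := integral_abs_centredSum_le hω hg hK
      simp only [norm_div, Real.norm_eq_abs, Nat.abs_cast]
      rw [integral_div, condAvg, ← mul_div_assoc, ← add_div]
      gcongr
      simpa using this
  have hlim := tendsto_integral_of_tendstoInMeasure hp (K := 1)
    (fun H ω => by
      rw [Real.norm_of_nonneg ENNReal.toReal_nonneg]
      exact ENNReal.toReal_mono ENNReal.one_ne_top (hp1 _ _))
    fun H => ((hpm H).comp (h.measurable_cond H)).ennreal_toReal.aestronglyMeasurable
  rw [integral_zero] at hlim
  have hlim2 := ENNReal.tendsto_ofReal hlim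
  rw [ENNReal.ofReal_zero] at hlim2
  refine hlim2.congr fun H => ?_
  have hpY : Measurable fun ω => p H (Y H ω) := (hpm H).comp (h.measurable_cond H)
  rw [integral_toReal hpY.aemeasurable
    (.of_forall fun ω => (hp1 _ _).trans_lt ENNReal.one_lt_top), ENNReal.ofReal_toReal]
  · rw [← h.measure_eq_lintegral H (hs H)]
    congr 1
    ext ω
    simp only [hs_def, sub_zero, sum_sub_condAvg]
    rfl
  · refine ((lintegral_mono fun ω => hp1 H _).trans_lt (b := ∫⁻ _, 1 ∂P) ?_).ne
    simp

/-- Central limit theorem for conditionally independent arrays: if the conditional means are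
asymptotically normal with variance `w` and the averaged conditional variances converge to `v`, then
the averages of the array are asymptotically normal with variance `w + v`. -/
theorem tendstoInDistribution_avg (h : IsCondIndepArray P ν Y X κ) {f : E → ℝ}
    (hf : Measurable f) (hi : MemLp f 2 ν) {v w : NNReal} {m : ℝ}
    (hv : TendstoInMeasure P (fun H ω => condVarAvg κ f H (Y H ω)) atTop fun _ => (v : ℝ))
    (hw : TendstoInDistribution (fun (H : ℕ) ω => √(H : ℝ) * (condAvg κ f H (Y H ω) - m)) atTop
      (id : ℝ → ℝ) (fun _ => P) (gaussianReal 0 w)) :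
    TendstoInDistribution (fun (H : ℕ) ω => √(H : ℝ) * ((∑ j, f (X H ω j)) / H - m)) atTop
      (id : ℝ → ℝ) (fun _ => P) (gaussianReal 0 (w + v)) := by
  have hXm : ∀ H : ℕ, Measurable fun ω => √(H : ℝ) * ((∑ j, f (X H ω j)) / H - m) := fun H =>
    (((Finset.measurable_fun_sum _ fun j _ => hf.comp
      ((measurable_pi_apply j).comp (h.measurable_array H))).div_const _).sub_const _).const_mul _
  have hBm : ∀ H : ℕ, Measurable fun y => √(H : ℝ) * (condAvg κ f H y - m) := fun H =>
    ((measurable_condAvg hf H).sub_const _).const_mul _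
  refine ⟨fun H => (hXm H).aemeasurable, aemeasurable_id,
    ProbabilityMeasure.tendsto_iff_tendsto_charFun.2 fun u => ?_⟩
  have hw' := ProbabilityMeasure.tendsto_iff_tendsto_charFun.1 hw.tendsto u
  simp only [ProbabilityMeasure.coe_mk, Measure.map_id, charFun_apply_real]
    at hw' ⊢
  set B : ℕ → Ω → ℂ := fun H ω =>
    Complex.exp (u * ((√(H : ℝ) * (condAvg κ f H (Y H ω) - m) : ℝ) : ℂ) * Complex.I) with hB
  set Φ : ℕ → Ω → ℂ := fun H ω => ∫ x, Complex.exp (Complex.I *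
        ((u / √(H : ℝ) * centredSum (fun j => κ H j (Y H ω)) f x : ℝ) : ℂ))
          ∂(Measure.pi fun j => κ H j (Y H ω)) with hΦ
  have hBmeas : ∀ H, Measurable (B H) := fun H => by
    have := (hBm H).comp (h.measurable_cond H)
    simp only [Function.comp_def] at this
    fun_prop
  have hBnorm : ∀ H ω, ‖B H ω‖ = 1 := fun H ω => by
    rw [hB]
    simp only
    rw [← Complex.ofReal_mul, Complex.norm_exp_ofReal_mul_I]
  have hGm : ∀ H, Measurable fun p : 𝒴 H × (Fin H → E) => Complex.exp (Complex.I *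
      ((u / √(H : ℝ) * centredSum (fun j => κ H j p.1) f p.2 : ℝ) : ℂ)) := fun H => by
    have := measurable_centredSum_kernel (κ := κ) hf H
    fun_prop
  have hΦmeas : ∀ H, Measurable (Φ H) := fun H =>
    ((hGm H).stronglyMeasurable.integral_kernel_prod_right'
      (κ := piKernel (κ H))).measurable.comp (h.measurable_cond H)
  have hΦnorm : ∀ H ω, ‖Φ H ω‖ ≤ 1 := fun H ω =>
    (norm_integral_le_of_norm_le_const (C := 1)
      (.of_forall fun x => (Complex.norm_exp_I_mul_ofReal _).le)).trans (by simp)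
  have hΦlim := h.tendstoInMeasure_cexp_centredSum hf hi hv u
  set c : ℂ := (Real.exp (-(u ^ 2 / 2 * v)) : ℂ) with hc
  have hcnorm : ‖c‖ ≤ 1 := by
    rw [hc, Complex.norm_real, Real.norm_of_nonneg (Real.exp_pos _).le, Real.exp_le_one_iff]
    simp only [Left.neg_nonpos_iff]
    positivity
  -- Conditioning on `Y H` factors the characteristic function into the contribution `B` of the
  -- conditional means and the conditional characteristic function `Φ` of the centred sum.
  have s1 : ∀ H : ℕ, ∫ x, Complex.exp (u * x * Complex.I)
      ∂(P.map fun ω => √(H : ℝ) * ((∑ j, f (X H ω j)) / H - m)) = ∫ ω, B H ω * Φ H ω ∂P := by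
    intro H
    rw [integral_map (hXm H).aemeasurable (by fun_prop)]
    have hsplit : ∀ ω, Complex.exp (u * ((√(H : ℝ) * ((∑ j, f (X H ω j)) / H - m) : ℝ) : ℂ)
          * Complex.I)
        = Complex.exp (u * ((√(H : ℝ) * (condAvg κ f H (Y H ω) - m) : ℝ) : ℂ) * Complex.I)
          * Complex.exp (Complex.I *
            ((u / √(H : ℝ) * centredSum (fun j => κ H j (Y H ω)) f (X H ω) : ℝ) : ℂ)) := by
      intro ω
      have e : √(H : ℝ) * ((∑ j, f (X H ω j)) / H - m) = √(H : ℝ) * (condAvg κ f H (Y H ω) - m)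
          + 1 / √(H : ℝ) * centredSum (fun j => κ H j (Y H ω)) f (X H ω) := by
        rw [← Real.sqrt_div_self', div_mul_eq_mul_div, mul_div_assoc, ← sum_sub_condAvg]
        ring
      rw [e, ← Complex.exp_add]
      push_cast
      ring_nf
    simp_rw [hsplit]
    refine (h.integral_comp_eq H (G := fun p => Complex.exp (u * ((√(H : ℝ)
        * (condAvg κ f H p.1 - m) : ℝ) : ℂ) * Complex.I) * Complex.exp (Complex.I *
            ((u / √(H : ℝ) * centredSum (fun j => κ H j p.1) f p.2 : ℝ) : ℂ))) ?_ (K := 1) ?_).trans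
      ?_
    · refine Measurable.mul ?_ (hGm H)
      have := (hBm H).comp (measurable_fst : Measurable (Prod.fst : 𝒴 H × (Fin H → E) → 𝒴 H))
      simp only [Function.comp_def] at this
      fun_prop
    · intro p
      rw [norm_mul, Complex.norm_exp_I_mul_ofReal, ← Complex.ofReal_mul,
        Complex.norm_exp_ofReal_mul_I, mul_one]
    · simp only [integral_const_mul, hB, hΦ]
  have s2 : ∀ H : ℕ, ∫ x, Complex.exp (u * x * Complex.I)
      ∂(P.map fun ω => √(H : ℝ) * (condAvg κ f H (Y H ω) - m)) = ∫ ω, B H ω ∂P := by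
    intro H
    have hBY : Measurable fun ω => √(H : ℝ) * (condAvg κ f H (Y H ω) - m) :=
      (hBm H).comp (h.measurable_cond H)
    rw [integral_map hBY.aemeasurable (by fun_prop)]
  simp_rw [s2] at hw'
  simp_rw [s1]
  have hdiff : TendstoInMeasure P (fun H ω => B H ω * (Φ H ω - c)) atTop fun _ => (0 : ℂ) := by
    rw [tendstoInMeasure_iff_norm] at hΦlim ⊢
    intro ε hε
    refine (hΦlim ε hε).congr fun H => ?_
    simp only [sub_zero, norm_mul, hBnorm, one_mul, hΦ]
  have hlim := tendsto_integral_of_tendstoInMeasure hdiff (K := 2)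
    (fun H ω => by
      rw [norm_mul, hBnorm, one_mul]
      exact (norm_sub_le _ _).trans (by linarith [hΦnorm H ω]))
    fun H => ((hBmeas H).mul ((hΦmeas H).sub_const c)).aestronglyMeasurable
  have hsum := hlim.add (hw'.mul_const c)
  have hbi : ∀ H, Integrable (B H) P := fun H =>
    .of_bound (hBmeas H).aestronglyMeasurable 1 (.of_forall fun ω => (hBnorm H ω).le)
  have hbi2 : ∀ H, Integrable (fun ω => B H ω * (Φ H ω - c)) P := fun H =>
    .of_bound ((hBmeas H).mul ((hΦmeas H).sub_const c)).aestronglyMeasurable 2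
      (.of_forall fun ω => by
        rw [norm_mul, hBnorm, one_mul]
        exact (norm_sub_le _ _).trans (by linarith [hΦnorm H ω]))
  have hgauss : ∀ r : NNReal, ∫ x, Complex.exp (u * x * Complex.I) ∂(gaussianReal 0 r)
      = Complex.exp (u * ((0 : ℝ) : ℂ) * Complex.I - (r : ℝ) * u ^ 2 / 2) := fun r =>
    (charFun_apply_real u).symm.trans (charFun_gaussianReal u)
  have e : Complex.exp (u * ((0 : ℝ) : ℂ) * Complex.I - ((w + v : NNReal) : ℝ) * u ^ 2 / 2)
      = ∫ _, (0 : ℂ) ∂P + Complex.exp (u * ((0 : ℝ) : ℂ) * Complex.I - (w : ℝ) * u ^ 2 / 2) * c := by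
    rw [integral_zero, zero_add, hc, Complex.ofReal_exp, ← Complex.exp_add]
    push_cast
    ring_nf
  rw [hgauss] at hsum ⊢
  rw [e]
  refine hsum.congr fun H => ?_
  rw [← integral_mul_const, ← integral_add (hbi2 H) ((hbi H).mul_const c)]
  refine integral_congr_ae (.of_forall fun ω => ?_)
  simp only
  ring

end IsCondIndepArray

/-! ### Joint laws from conditional laws -/

section CondLaw

/-- If the conditional law of `X` given a σ-algebra `m` is a Markov kernel `κ` evaluated at an
`m`-measurable variable `Y`, then the joint law of `(Y, X)` is obtained from the law of `Y` by means
of `κ`. In particular, only the part of the past that enters the kernel matters. -/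
lemma map_prodMk_of_hasCondLaw {Ω 𝒴 E : Type*} [MeasurableSpace 𝒴] [MeasurableSpace E]
    {m mΩ : MeasurableSpace Ω} {P : Measure Ω} [IsProbabilityMeasure P] (hm : m ≤ mΩ)
    {Y : Ω → 𝒴} {X : Ω → E} (hY : Measurable[m] Y) (hX : Measurable X) (κ : Kernel 𝒴 E)
    [IsMarkovKernel κ] (h : HasCondLaw X m (fun ω => κ (Y ω)) P) :
    P.map (fun ω => (Y ω, X ω)) = (P.map Y) ⊗ₘ κ := by
  have hY' : Measurable Y := hY.mono hm le_rfl
  have : IsProbabilityMeasure (P.map Y) := Measure.isProbabilityMeasure_map hY'.aemeasurable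
  have : IsProbabilityMeasure (P.map fun ω => (Y ω, X ω)) :=
    Measure.isProbabilityMeasure_map (hY'.prodMk hX).aemeasurable
  refine Measure.ext_prod fun {s t} hs ht => ?_
  rw [Measure.map_apply (hY'.prodMk hX) (hs.prod ht), Measure.compProd_apply_prod hs ht,
    setLIntegral_map hs (κ.measurable_coe ht) hY']
  have hXt : MeasurableSet (X ⁻¹' t) := hX ht
  have hint : Integrable ((X ⁻¹' t).indicator fun _ => (1 : ℝ)) P :=
    (integrable_const _).indicator hXt
  have e := setIntegral_condExp hm hint (hY hs)
  rw [setIntegral_congr_ae (g := fun ω => (κ (Y ω)).real t) (hm _ (hY hs))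
    ((h t ht).mono fun ω hω _ => hω), integral_indicator_const (μ := P.restrict (Y ⁻¹' s)) _ hXt,
    smul_eq_mul, mul_one, measureReal_restrict_apply hXt] at e
  have e2 : ENNReal.ofReal (∫ ω in Y ⁻¹' s, (κ (Y ω)).real t ∂P)
      = ∫⁻ ω in Y ⁻¹' s, κ (Y ω) t ∂P := by
    have hmeas : Measurable fun ω => κ (Y ω) t := (κ.measurable_coe ht).comp hY'
    simp only [Measure.real]
    rw [integral_toReal hmeas.aemeasurable (.of_forall fun ω => measure_lt_top _ _),
      ENNReal.ofReal_toReal]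
    refine ((lintegral_mono fun ω => prob_le_one (μ := κ (Y ω))).trans_lt
      (b := ∫⁻ _ in Y ⁻¹' s, 1 ∂P) ?_).ne
    simp
  rw [← e2, e, Measure.real, ENNReal.ofReal_toReal (measure_ne_top _ _)]
  congr 1
  ext ω
  simp [and_comm]

end CondLaw

/-! ### Weighted empirical measures -/

section WeightedEmpirical

variable {F : Type*} [MeasurableSpace F]

lemma sum_posWeight_pos {H : ℕ} (hH : 0 < H) (w : Fin H → PosWeight) : 0 < ∑ l, (w l : ℝ) :=
  Finset.sum_pos (fun l _ => (w l).2) ⟨⟨0, hH⟩, Finset.mem_univ _⟩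

lemma weight_ratio_nonneg {H : ℕ} (w : Fin H → PosWeight) (i : Fin H) :
    0 ≤ (w i : ℝ) / ∑ l, (w l : ℝ) :=
  div_nonneg (le_of_lt (w i).2) (Finset.sum_nonneg fun l _ => le_of_lt (w l).2)

lemma lintegral_weightedEmpirical {H : ℕ} (c : Fin H → F) (w : Fin H → PosWeight) {f : F → ENNReal}
    (hf : Measurable f) : ∫⁻ x, f x ∂(weightedEmpirical c w)
      = ∑ i, ENNReal.ofReal ((w i : ℝ) / ∑ l, (w l : ℝ)) * f (c i) := by
  rw [weightedEmpirical, lintegral_finsetSum_measure]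
  simp_rw [lintegral_smul_measure, lintegral_dirac' _ hf, smul_eq_mul]

lemma integrable_weightedEmpirical {H : ℕ} (c : Fin H → F) (w : Fin H → PosWeight) {f : F → ℝ}
    (hf : Measurable f) : Integrable f (weightedEmpirical c w) := by
  refine ⟨hf.aestronglyMeasurable, ?_⟩
  rw [hasFiniteIntegral_iff_enorm, lintegral_weightedEmpirical c w hf.enorm]
  exact ENNReal.sum_lt_top.2 fun i _ => ENNReal.mul_lt_top ENNReal.ofReal_lt_top enorm_lt_top

lemma integral_weightedEmpirical {H : ℕ} (c : Fin H → F) (w : Fin H → PosWeight) {f : F → ℝ}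
    (hf : Measurable f) : ∫ x, f x ∂(weightedEmpirical c w)
      = ∑ i, (w i : ℝ) / (∑ l, (w l : ℝ)) * f (c i) := by
  have hd : ∀ i, Integrable f
      (ENNReal.ofReal ((w i : ℝ) / ∑ l, (w l : ℝ)) • Measure.dirac (c i)) := by
    refine fun i => Integrable.smul_measure ⟨hf.aestronglyMeasurable, ?_⟩ ENNReal.ofReal_ne_top
    rw [hasFiniteIntegral_iff_enorm, lintegral_dirac' _ hf.enorm]
    exact enorm_lt_top
  rw [weightedEmpirical, integral_finsetSum_measure fun i _ => hd i]
  refine Finset.sum_congr rfl fun i _ => ?_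
  rw [integral_smul_measure, integral_dirac' _ _ hf.stronglyMeasurable,
    ENNReal.toReal_ofReal (weight_ratio_nonneg w i), smul_eq_mul]

lemma isProbabilityMeasure_weightedEmpirical {H : ℕ} (hH : 0 < H) (c : Fin H → F)
    (w : Fin H → PosWeight) : IsProbabilityMeasure (weightedEmpirical c w) := by
  refine ⟨?_⟩
  rw [← setLIntegral_one, Measure.restrict_univ, lintegral_weightedEmpirical c w measurable_const]
  simp only [mul_one]
  rw [← ENNReal.ofReal_sum_of_nonneg fun i _ => weight_ratio_nonneg w i, ← Finset.sum_div,
    div_self (sum_posWeight_pos hH w).ne', ENNReal.ofReal_one]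

/-- The weighted empirical measure as a kernel; it does not depend on the index `j` of the particle
that is to be drawn. -/
def selectionKernel (F : Type*) [MeasurableSpace F] (H : ℕ) (_j : Fin H) :
    Kernel (Fin H → F × PosWeight) F where
  toFun y := weightedEmpirical (fun i => (y i).1) fun i => (y i).2
  measurable' := by
    refine Measure.measurable_of_measurable_coe _ fun s hs => ?_
    have e : ∀ y : Fin H → F × PosWeight,
        weightedEmpirical (fun i => (y i).1) (fun i => (y i).2) s
          = ∑ i, ENNReal.ofReal (((y i).2 : ℝ) / ∑ l, ((y l).2 : ℝ)) * s.indicator 1 (y i).1 := by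
      intro y
      rw [← lintegral_weightedEmpirical _ _ (measurable_one.indicator hs),
        lintegral_indicator_one hs]
    simp_rw [e]
    have h1 : ∀ i : Fin H, Measurable fun y : Fin H → F × PosWeight => ((y i).2 : ℝ) := fun i =>
      measurable_subtype_coe.comp (measurable_snd.comp (measurable_pi_apply i))
    have h2 : ∀ i : Fin H, Measurable fun y : Fin H → F × PosWeight =>
        s.indicator (1 : F → ENNReal) (y i).1 := fun i =>
      (measurable_one.indicator hs).comp (measurable_fst.comp (measurable_pi_apply i))
    exact Finset.measurable_fun_sum _ fun i _ =>
      (((h1 i).div (Finset.measurable_fun_sum _ fun l _ => h1 l)).ennreal_ofReal).mul (h2 i)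

lemma selectionKernel_apply {H : ℕ} (j : Fin H) (y : Fin H → F × PosWeight) :
    selectionKernel F H j y = weightedEmpirical (fun i => (y i).1) fun i => (y i).2 := rfl

instance (H : ℕ) (j : Fin H) : IsMarkovKernel (selectionKernel F H j) :=
  ⟨fun _ => isProbabilityMeasure_weightedEmpirical j.pos _ _⟩

lemma condAvg_selectionKernel {f : F → ℝ} (hf : Measurable f) {H : ℕ} (hH : 0 < H)
    (y : Fin H → F × PosWeight) :
    condAvg (selectionKernel F) f H y
      = ∑ i, ((y i).2 : ℝ) / (∑ l, ((y l).2 : ℝ)) * f (y i).1 := by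
  have : (H : ℝ) ≠ 0 := Nat.cast_ne_zero.2 hH.ne'
  simp only [condAvg, selectionKernel_apply]
  rw [Finset.sum_const, Finset.card_univ, Fintype.card_fin, nsmul_eq_mul,
    mul_div_cancel_left₀ _ this, integral_weightedEmpirical _ _ hf]

lemma condVarAvg_selectionKernel {f : F → ℝ} (hf : Measurable f) {H : ℕ} (hH : 0 < H)
    (y : Fin H → F × PosWeight) :
    condVarAvg (selectionKernel F) f H y
      = condAvg (selectionKernel F) (fun x => f x ^ 2) H y
        - condAvg (selectionKernel F) f H y ^ 2 := by
  have h0 : (H : ℝ) ≠ 0 := Nat.cast_ne_zero.2 hH.ne'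
  have := isProbabilityMeasure_weightedEmpirical hH (fun i => (y i).1) fun i => (y i).2
  have h2 : MemLp f 2 (weightedEmpirical (fun i => (y i).1) fun i => (y i).2) :=
    (memLp_two_iff_integrable_sq hf.aestronglyMeasurable).2
      (integrable_weightedEmpirical _ _ (hf.pow_const 2))
  simp only [condVarAvg, condAvg, selectionKernel_apply]
  rw [Finset.sum_const, Finset.sum_const, Finset.sum_const, Finset.card_univ, Fintype.card_fin,
    nsmul_eq_mul, nsmul_eq_mul, nsmul_eq_mul, mul_div_cancel_left₀ _ h0,
    mul_div_cancel_left₀ _ h0, mul_div_cancel_left₀ _ h0, variance_eq_sub h2]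
  rfl

end WeightedEmpirical

/-! ### Unbiased weights -/

section Comp

variable {E F : Type*} [MeasurableSpace E] [MeasurableSpace F] {μ : Measure E} {κ : Kernel E F}
  {f : F → ℝ}

lemma integrable_integral_of_integrable_comp (hf : Integrable f (κ ∘ₘ μ)) :
    Integrable (fun c => ∫ x, f x ∂(κ c)) μ := by
  rw [Measure.comp_eq_comp_const_apply] at hf
  simpa using hf.integral_comp

lemma integral_comp_measure (hf : Integrable f (κ ∘ₘ μ)) :
    ∫ x, f x ∂(κ ∘ₘ μ) = ∫ c, ∫ x, f x ∂(κ c) ∂μ := by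
  rw [Measure.comp_eq_comp_const_apply] at hf ⊢
  simpa using Kernel.integral_comp hf

end Comp

section Weights

variable {E F : Type*} [MeasurableSpace E] [MeasurableSpace F]

lemma measurable_normWeight (z : ℝ) : Measurable (normWeight z : F × PosWeight → ℝ) :=
  (measurable_subtype_coe.comp measurable_snd).div_const _

variable {μ : Measure E} {κ : Kernel E (F × PosWeight)} {z : ℝ} {ν : Measure F}

/-- Since the weights are strictly positive, unbiasedness forces the law of the new particle to be
absolutely continuous with respect to the target. -/
lemma UnbiasedWeights.map_fst_absolutelyContinuous [IsFiniteMeasure ν]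
    (h : UnbiasedWeights μ κ z ν) :
    (κ ∘ₘ μ).map Prod.fst ≪ ν := by
  refine Measure.AbsolutelyContinuous.mk fun s hs hs0 => ?_
  rw [Measure.map_apply measurable_fst hs]
  obtain ⟨hi, he⟩ := h (s.indicator fun _ => (1 : ℝ)) ((integrable_const _).indicator hs)
  rw [integral_indicator_const _ hs, Measure.real, hs0] at he
  simp only [ENNReal.toReal_zero, zero_smul, mul_zero] at he
  rw [integral_eq_zero_iff_of_nonneg (fun x => mul_nonneg (le_of_lt x.2.2)
    (Set.indicator_nonneg (fun _ _ => zero_le_one) _)) hi] at he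
  refine measure_mono_null (fun x hx => ?_) he
  intro (hc : (x.2 : ℝ) * s.indicator (fun _ => (1 : ℝ)) x.1 = 0)
  rw [Set.indicator_of_mem (show x.1 ∈ s from hx), mul_one] at hc
  exact absurd hc (ne_of_gt x.2.2)

lemma UnbiasedWeights.ae_comp_fst [IsFiniteMeasure ν] (h : UnbiasedWeights μ κ z ν) {p : F → Prop}
    (hp : ∀ᵐ x ∂ν, p x) : ∀ᵐ x ∂(κ ∘ₘ μ), p x.1 :=
  ae_of_ae_map measurable_fst.aemeasurable (h.map_fst_absolutelyContinuous.ae_le hp)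

lemma UnbiasedWeights.integrable_normWeight_mul (h : UnbiasedWeights μ κ z ν) {φ : F → ℝ}
    (hφ : Integrable φ ν) :
    Integrable (fun x : F × PosWeight => normWeight z x * φ x.1) (κ ∘ₘ μ) := by
  refine ((h φ hφ).1.div_const z).congr (.of_forall fun x => ?_)
  simp only [normWeight]
  ring

variable [IsProbabilityMeasure μ] [IsMarkovKernel κ] [IsProbabilityMeasure ν]

lemma UnbiasedWeights.pos (h : UnbiasedWeights μ κ z ν) : 0 < z := by
  obtain ⟨hi, he⟩ := h (fun _ => 1) (integrable_const _)
  simp only [mul_one, integral_const, probReal_univ, smul_eq_mul] at hi he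
  rw [← he, integral_pos_iff_support_of_nonneg (fun x => le_of_lt x.2.2) hi]
  have : (Function.support fun x : F × PosWeight => (x.2 : ℝ)) = Set.univ :=
    Set.eq_univ_of_forall fun x => ne_of_gt x.2.2
  rw [this, measure_univ]
  exact one_pos

lemma UnbiasedWeights.integral_normWeight_mul (h : UnbiasedWeights μ κ z ν) {φ : F → ℝ}
    (hφ : Integrable φ ν) :
    ∫ x : F × PosWeight, normWeight z x * φ x.1 ∂(κ ∘ₘ μ) = ∫ c, φ c ∂ν := by
  have e : ∀ x : F × PosWeight, normWeight z x * φ x.1 = (x.2 : ℝ) * φ x.1 / z := fun x => by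
    simp only [normWeight]
    ring
  simp_rw [e]
  rw [integral_div, (h φ hφ).2, mul_div_cancel_left₀ _ h.pos.ne']

end Weights

/-! ### Mutation and selection as conditionally independent arrays -/

section Steps

variable {Ω E F : Type*} [MeasurableSpace Ω] [MeasurableSpace E] [MeasurableSpace F]
  {P : Measure Ω}

/-- The kernel that moves the `j`-th particle of a sample. -/
abbrev mutationKernel (κ : Kernel E F) (H : ℕ) (j : Fin H) : Kernel (Fin H → E) F :=
  κ.comap (fun y : Fin H → E => y j) (measurable_pi_apply j)

lemma condAvg_mutationKernel (κ : Kernel E F) (f : F → ℝ) (H : ℕ) (y : Fin H → E) :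
    condAvg (mutationKernel κ) f H y = (∑ j, ∫ x, f x ∂(κ (y j))) / H := by
  simp [condAvg, Kernel.comap_apply]

lemma condVarAvg_mutationKernel (κ : Kernel E F) (f : F → ℝ) (H : ℕ) (y : Fin H → E) :
    condVarAvg (mutationKernel κ) f H y = (∑ j, Var[f; κ (y j)]) / H := by
  simp [condVarAvg, Kernel.comap_apply]

lemma ae_forall_of_absolutelyContinuous {μ : Measure E} {H : ℕ} {A : Fin H → Ω → E}
    (hA : ∀ j, Measurable (A j)) (hac : ∀ j, P.map (A j) ≪ μ) {p : E → Prop} (hp : ∀ᵐ c ∂μ, p c) :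
    ∀ᵐ ω ∂P, ∀ j, p (A j ω) :=
  ae_all_iff.2 fun j => ae_of_ae_map (hA j).aemeasurable ((hac j).ae_le hp)

/-- A sample `A` that satisfies the weak law of large numbers for `μ`, mutated by the kernel `κ`. -/
lemma isCondIndepArray_mutation {μ : Measure E} [IsProbabilityMeasure μ] (κ : Kernel E F)
    [IsMarkovKernel κ] {A : ∀ H, Fin H → Ω → E} {X : ∀ H, Ω → Fin H → F}
    (hA : ∀ H j, Measurable (A H j)) (hX : ∀ H, Measurable (X H))
    (hac : ∀ H j, P.map (A H j) ≪ μ)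
    (hlln : ∀ f : E → ℝ, Measurable f → Integrable f μ →
      TendstoInMeasure P (fun H ω => (∑ j, f (A H j ω)) / H) atTop fun _ => ∫ c, f c ∂μ)
    (hlaw : ∀ H, P.map (fun ω => ((fun j => A H j ω), X H ω))
      = (P.map fun ω j => A H j ω) ⊗ₘ piKernel (mutationKernel κ H)) :
    IsCondIndepArray P (κ ∘ₘ μ) (fun H ω j => A H j ω) X (mutationKernel κ) where
  measurable_cond H := measurable_pi_lambda _ fun j => hA H j
  measurable_array := hX
  map_eq := hlaw
  lintegral_ne_top f hf hfi H := by
    rw [Measure.lintegral_bind κ.measurable.aemeasurable hf.aemeasurable] at hfi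
    have := ae_lt_top hf.lintegral_kernel hfi
    filter_upwards [ae_forall_of_absolutelyContinuous (hA H) (hac H) this] with ω hω j
    rw [Kernel.comap_apply]
    exact (hω j).ne
  tendsto_condAvg f hf hfi := by
    have := hlln _ hf.stronglyMeasurable.integral_kernel.measurable
      (integrable_integral_of_integrable_comp hfi)
    rw [← integral_comp_measure hfi] at this
    simpa only [condAvg_mutationKernel] using this

/-- If the pairs of particle and weight form an array with limit `κ ∘ₘ μ`, and the weights are
unbiased for `ν`, then multinomial resampling yields an array with limit `ν`. -/
lemma isCondIndepArray_selection [IsProbabilityMeasure P] {μ : Measure E} [IsProbabilityMeasure μ]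
    {κ : Kernel E (F × PosWeight)} [IsMarkovKernel κ] {z : ℝ} {ν : Measure F}
    [IsProbabilityMeasure ν] (hw : UnbiasedWeights μ κ z ν)
    {X : ∀ H, Ω → Fin H → F × PosWeight} {A : ∀ H, Ω → Fin H → F}
    (hX : ∀ H, Measurable (X H)) (hA : ∀ H, Measurable (A H))
    (hac : ∀ H j, P.map (fun ω => X H ω j) ≪ κ ∘ₘ μ)
    (hlln : ∀ f : F × PosWeight → ℝ, Measurable f → Integrable f (κ ∘ₘ μ) →
      TendstoInMeasure P (fun H ω => (∑ j, f (X H ω j)) / H) atTop fun _ => ∫ x, f x ∂(κ ∘ₘ μ))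
    (hlaw : ∀ H, P.map (fun ω => (X H ω, A H ω))
      = (P.map (X H)) ⊗ₘ piKernel (selectionKernel F H)) :
    IsCondIndepArray P ν X A (selectionKernel F) where
  measurable_cond := hX
  measurable_array := hA
  map_eq := hlaw
  lintegral_ne_top f hf hfi H := by
    have h1 := hw.ae_comp_fst (ae_lt_top hf hfi)
    filter_upwards [ae_forall_of_absolutelyContinuous
      (fun j => (measurable_pi_apply j).comp (hX H)) (hac H) h1] with ω hω j
    rw [selectionKernel_apply, lintegral_weightedEmpirical _ _ hf]
    exact (ENNReal.sum_lt_top.2 fun i _ =>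
      ENNReal.mul_lt_top ENNReal.ofReal_lt_top (hω i)).ne
  tendsto_condAvg f hf hfi := by
    have hz := hw.pos
    have hnum := hlln (fun x => normWeight z x * f x.1)
      ((measurable_normWeight z).mul (hf.comp measurable_fst))
      (hw.integrable_normWeight_mul hfi)
    have hden := hlln (fun x => normWeight z x * 1) ((measurable_normWeight z).mul_const 1)
      (hw.integrable_normWeight_mul (φ := fun _ => 1) (integrable_const (1 : ℝ)))
    rw [hw.integral_normWeight_mul hfi] at hnum
    rw [hw.integral_normWeight_mul (φ := fun _ => 1) (integrable_const (1 : ℝ)), integral_const,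
      probReal_univ, smul_eq_mul, mul_one] at hden
    have := tendstoInMeasure_comp_prodMk (g := fun p : ℝ × ℝ => p.1 / p.2)
      (a := ∫ c, f c ∂ν) (b := 1) (continuousAt_fst.div continuousAt_snd one_ne_zero) hnum hden
    simp only [div_one] at this
    refine this.congr' ?_ (EventuallyEq.refl _ _)
    filter_upwards [eventually_gt_atTop 0] with H hH
    refine .of_forall fun ω => ?_
    have h0 : (H : ℝ) ≠ 0 := Nat.cast_ne_zero.2 hH.ne'
    have hs := (sum_posWeight_pos hH fun i => (X H ω i).2).ne'
    simp only [condAvg_selectionKernel hf hH, normWeight, mul_one]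
    rw [← Finset.sum_div, div_div_div_cancel_right₀ h0, Finset.sum_div]
    refine Finset.sum_congr rfl fun i _ => ?_
    field_simp

end Steps

/-! ### One level of the algorithm -/

section OneLevel

variable {E F : Type*} [MeasurableSpace E] [MeasurableSpace F]

lemma measurable_variance_kernel {κ : Kernel E F} [IsMarkovKernel κ] {f : F → ℝ}
    (hf : Measurable f) : Measurable fun c => Var[f; κ c] := by
  have h : Measurable fun p : E × F => ‖f p.2 - ∫ x, f x ∂(κ p.1)‖ₑ ^ 2 :=
    ((hf.comp measurable_snd).sub
      (hf.stronglyMeasurable.integral_kernel.measurable.comp measurable_fst)).enorm.pow_const 2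
  exact (h.lintegral_kernel_prod_right' (κ := κ)).ennreal_toReal

lemma integrable_variance_kernel {μ : Measure E} {κ : Kernel E F} [IsMarkovKernel κ] {f : F → ℝ}
    (hf : Measurable f) (hi : MemLp f 2 (κ ∘ₘ μ)) : Integrable (fun c => Var[f; κ c]) μ := by
  refine (integrable_integral_of_integrable_comp hi.integrable_sq).mono'
    (measurable_variance_kernel hf).aestronglyMeasurable (.of_forall fun c => ?_)
  rw [Real.norm_of_nonneg (variance_nonneg _ _)]
  exact variance_le_expectation_sq hf.aestronglyMeasurable

variable {Ω : Type*} [MeasurableSpace Ω] {P : Measure Ω}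

lemma exists_measurable_memLp_ae_eq {ν : Measure E} {f : E → ℝ} (hf : MemLp f 2 ν) :
    ∃ g : E → ℝ, Measurable g ∧ MemLp g 2 ν ∧ f =ᵐ[ν] g :=
  ⟨hf.1.mk f, hf.1.stronglyMeasurable_mk.measurable, hf.ae_eq hf.1.ae_eq_mk, hf.1.ae_eq_mk⟩

lemma ae_avg_eq {ν : Measure E} {H : ℕ} {A : Fin H → Ω → E} (hA : ∀ j, Measurable (A j))
    (hac : ∀ j, P.map (A j) ≪ ν) {f g : E → ℝ} (hfg : f =ᵐ[ν] g) (m : ℝ) :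
    (fun ω => √(H : ℝ) * ((∑ j, g (A j ω)) / H - m))
      =ᵐ[P] fun ω => √(H : ℝ) * ((∑ j, f (A j ω)) / H - m) := by
  filter_upwards [ae_forall_of_absolutelyContinuous hA hac hfg] with ω hω
  rw [Finset.sum_congr rfl fun j _ => hω j]

variable [IsProbabilityMeasure P]

/-- Asymptotic normality of the ratio estimator `∑ W φ(C) / ∑ W`. It is the quotient of the
averages of `V (φ - m)` and `V`; the former is asymptotically normal and the latter tends to one. -/
lemma tendstoInDistribution_ratio {μ : Measure E} [IsProbabilityMeasure μ]
    {κ : Kernel E (F × PosWeight)} [IsMarkovKernel κ] {z : ℝ} {ν : Measure F}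
    [IsProbabilityMeasure ν] (hunb : UnbiasedWeights μ κ z ν) {X : ∀ H, Ω → Fin H → F × PosWeight}
    (hX : ∀ H, Measurable (X H))
    (hlln : ∀ f : F × PosWeight → ℝ, Measurable f → Integrable f (κ ∘ₘ μ) →
      TendstoInMeasure P (fun H ω => (∑ j, f (X H ω j)) / H) atTop fun _ => ∫ x, f x ∂(κ ∘ₘ μ))
    {φ : F → ℝ} (m : ℝ) {v : NNReal}
    (hnum : TendstoInDistribution (fun (H : ℕ) ω => √(H : ℝ) *
      ((∑ j, normWeight z (X H ω j) * (φ (X H ω j).1 - m)) / H - 0)) atTop (id : ℝ → ℝ)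
      (fun _ => P) (gaussianReal 0 v)) :
    TendstoInDistribution (fun (H : ℕ) ω => √(H : ℝ) *
      (∑ j, ((X H ω j).2 : ℝ) / (∑ l, ((X H ω l).2 : ℝ)) * φ (X H ω j).1 - m)) atTop (id : ℝ → ℝ)
      (fun _ => P) (gaussianReal 0 v) := by
  have hz := hunb.pos
  have hden := hlln (fun x => normWeight z x * 1) ((measurable_normWeight z).mul_const 1)
    (hunb.integrable_normWeight_mul (φ := fun _ => 1) (integrable_const (1 : ℝ)))
  rw [hunb.integral_normWeight_mul (φ := fun _ => 1) (integrable_const (1 : ℝ)), integral_const,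
    probReal_univ, smul_eq_mul, mul_one] at hden
  have hinv := tendstoInMeasure_comp (g := fun x : ℝ => x⁻¹) (continuousAt_inv₀ one_ne_zero) hden
  have hm : ∀ H : ℕ, Measurable fun ω => ((∑ j, normWeight z (X H ω j) * 1) / (H : ℝ))⁻¹ :=
    fun H => by
      have hXj : ∀ j, Measurable fun ω => X H ω j := fun j => (measurable_pi_apply j).comp (hX H)
      have hVj : ∀ j, Measurable fun ω => normWeight z (X H ω j) := fun j =>
        (measurable_normWeight z).comp (hXj j)
      fun_prop
  have := hnum.continuous_comp_prodMk_of_tendstoInMeasure_const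
    (g := fun p : ℝ × ℝ => p.1 * p.2) (by fun_prop) hinv fun H => (hm H).aemeasurable
  refine TendstoInDistribution.congr (fun H => .of_forall fun ω => ?_) ?_ this
  · rcases Nat.eq_zero_or_pos H with rfl | hH
    · simp
    have h0 : (H : ℝ) ≠ 0 := Nat.cast_ne_zero.2 hH.ne'
    have hs := (sum_posWeight_pos hH fun i => (X H ω i).2).ne'
    have e1 : (∑ j, normWeight z (X H ω j) * 1) / (H : ℝ) = (∑ l, ((X H ω l).2 : ℝ)) / z / H := by
      simp only [normWeight, mul_one, Finset.sum_div]
    have e2 : (∑ j, normWeight z (X H ω j) * (φ (X H ω j).1 - m)) / (H : ℝ)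
        = (∑ j, ((X H ω j).2 : ℝ) * φ (X H ω j).1 - (∑ l, ((X H ω l).2 : ℝ)) * m) / z / H := by
      have e : ∀ j, normWeight z (X H ω j) * (φ (X H ω j).1 - m)
          = (((X H ω j).2 : ℝ) * φ (X H ω j).1 - ((X H ω j).2 : ℝ) * m) / z := fun j => by
        simp only [normWeight]
        ring
      simp_rw [e]
      rw [← Finset.sum_div, Finset.sum_sub_distrib, Finset.sum_mul]
    have e3 : ∑ j, ((X H ω j).2 : ℝ) / (∑ l, ((X H ω l).2 : ℝ)) * φ (X H ω j).1
        = (∑ j, ((X H ω j).2 : ℝ) * φ (X H ω j).1) / ∑ l, ((X H ω l).2 : ℝ) := by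
      rw [Finset.sum_div]
      exact Finset.sum_congr rfl fun j _ => by ring
    simp only [e1, e2, e3, sub_zero]
    generalize ∑ l, ((X H ω l).2 : ℝ) = s at hs ⊢
    generalize ∑ j, ((X H ω j).2 : ℝ) * φ (X H ω j).1 = r
    field_simp
  · exact .of_forall fun x => by simp

/-- Asymptotic normality of a mutated sample: the variance of the conditional means is increased by
the mean conditional variance. -/
lemma tendstoInDistribution_mutation {μ : Measure E} [IsProbabilityMeasure μ] {κ : Kernel E F}
    [IsMarkovKernel κ] {A : ∀ H, Fin H → Ω → E} {X : ∀ H, Ω → Fin H → F}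
    (h : IsCondIndepArray P (κ ∘ₘ μ) (fun H ω j => A H j ω) X (mutationKernel κ))
    (hlln : ∀ f : E → ℝ, Measurable f → Integrable f μ →
      TendstoInMeasure P (fun H ω => (∑ j, f (A H j ω)) / H) atTop fun _ => ∫ c, f c ∂μ)
    {f : F → ℝ} (hf : Measurable f) (hi : MemLp f 2 (κ ∘ₘ μ)) {w : NNReal} {m : ℝ}
    (hw : TendstoInDistribution (fun (H : ℕ) ω => √(H : ℝ) *
      ((∑ j, ∫ x, f x ∂(κ (A H j ω))) / H - m)) atTop (id : ℝ → ℝ) (fun _ => P)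
      (gaussianReal 0 w)) :
    TendstoInDistribution (fun (H : ℕ) ω => √(H : ℝ) * ((∑ j, f (X H ω j)) / H - m)) atTop
      (id : ℝ → ℝ) (fun _ => P) (gaussianReal 0 (w + (∫ c, Var[f; κ c] ∂μ).toNNReal)) := by
  refine h.tendstoInDistribution_avg hf hi ?_ ?_
  · rw [Real.coe_toNNReal _ (integral_nonneg fun _ => variance_nonneg _ _)]
    simp only [condVarAvg_mutationKernel]
    exact hlln (fun c => Var[f; κ c]) (measurable_variance_kernel hf)
      (integrable_variance_kernel hf hi)
  · simpa only [condAvg_mutationKernel] using hw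

/-- Asymptotic normality of a resampled sample: multinomial resampling adds the variance under the
target. -/
lemma tendstoInDistribution_selection {ν : Measure F} [IsProbabilityMeasure ν]
    {X : ∀ H, Ω → Fin H → F × PosWeight} {A : ∀ H, Ω → Fin H → F}
    (h : IsCondIndepArray P ν X A (selectionKernel F)) {f : F → ℝ} (hf : Measurable f)
    (hi : MemLp f 2 ν) {w : NNReal} {m : ℝ}
    (hw : TendstoInDistribution (fun (H : ℕ) ω => √(H : ℝ) *
      (∑ j, ((X H ω j).2 : ℝ) / (∑ l, ((X H ω l).2 : ℝ)) * f (X H ω j).1 - m)) atTop (id : ℝ → ℝ)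
      (fun _ => P) (gaussianReal 0 w)) :
    TendstoInDistribution (fun (H : ℕ) ω => √(H : ℝ) * ((∑ j, f (A H ω j)) / H - m)) atTop
      (id : ℝ → ℝ) (fun _ => P) (gaussianReal 0 (w + (Var[f; ν]).toNNReal)) := by
  refine h.tendstoInDistribution_avg hf hi ?_ ?_
  · rw [Real.coe_toNNReal _ (variance_nonneg _ _), variance_eq_sub hi]
    have := tendstoInMeasure_comp_prodMk (g := fun p : ℝ × ℝ => p.1 - p.2 ^ 2) (by fun_prop)
      (h.tendsto_condAvg _ (hf.pow_const 2) hi.integrable_sq)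
      (h.tendsto_condAvg _ hf (hi.integrable one_le_two))
    refine this.congr' ?_ (EventuallyEq.refl _ _)
    filter_upwards [eventually_gt_atTop 0] with H hH
    exact .of_forall fun ω => (condVarAvg_selectionKernel hf hH _).symm
  · refine TendstoInDistribution.congr (fun H => .of_forall fun ω => ?_) (ae_eq_refl _) hw
    rcases Nat.eq_zero_or_pos H with rfl | hH
    · simp
    · simp only [condAvg_selectionKernel hf hH]

/-- I.i.d. samples are arrays with a trivial conditioning variable. -/
lemma isCondIndepArray_iid {ν : Measure E} [IsProbabilityMeasure ν] {A : ∀ H, Ω → Fin H → E}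
    (hA : ∀ H, Measurable (A H)) (hlaw : ∀ H, P.map (A H) = Measure.pi fun _ : Fin H => ν) :
    IsCondIndepArray P ν (fun _ _ => ()) A (fun _ _ => Kernel.const Unit ν) where
  measurable_cond _ := measurable_const
  measurable_array := hA
  map_eq H := by
    have e : P.map (fun _ : Ω => ()) = Measure.dirac () := by
      rw [Measure.map_const, measure_univ, one_smul]
    rw [e, Measure.dirac_unit_compProd, piKernel_apply]
    simp only [Kernel.const_apply]
    rw [← hlaw H, Measure.map_map measurable_prodMk_left (hA H)]
    rfl
  lintegral_ne_top f _ hfi H := .of_forall fun _ _ => by rwa [Kernel.const_apply]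
  tendsto_condAvg f _ _ := by
    refine tendstoInMeasure_of_tendsto_const
      (c := fun H => condAvg (fun _ _ => Kernel.const Unit ν) f H ()) (tendsto_const_nhds.congr' ?_)
    filter_upwards [eventually_gt_atTop 0] with H hH
    have h0 : (H : ℝ) ≠ 0 := Nat.cast_ne_zero.2 hH.ne'
    simp [condAvg, h0]

/-- The classical central limit theorem, for triangular arrays: here the conditional means do not
fluctuate at all. -/
lemma tendstoInDistribution_iid {ν : Measure E} [IsProbabilityMeasure ν]
    {A : ∀ H, Ω → Fin H → E}
    (h : IsCondIndepArray P ν (fun _ _ => ()) A (fun _ _ => Kernel.const Unit ν)) {f : E → ℝ}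
    (hf : Measurable f) (hi : MemLp f 2 ν) :
    TendstoInDistribution (fun (H : ℕ) ω => √(H : ℝ) * ((∑ j, f (A H ω j)) / H - ∫ x, f x ∂ν))
      atTop (id : ℝ → ℝ) (fun _ => P) (gaussianReal 0 (Var[f; ν]).toNNReal) := by
  rw [← zero_add (Var[f; ν]).toNNReal]
  refine h.tendstoInDistribution_avg hf hi ?_ ?_
  · rw [Real.coe_toNNReal _ (variance_nonneg _ _)]
    refine tendstoInMeasure_of_tendsto_const
      (c := fun H => condVarAvg (fun _ _ => Kernel.const Unit ν) f H ())
      (tendsto_const_nhds.congr' ?_)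
    filter_upwards [eventually_gt_atTop 0] with H hH
    have h0 : (H : ℝ) ≠ 0 := Nat.cast_ne_zero.2 hH.ne'
    simp [condVarAvg, h0]
  · have e : ∀ H : ℕ, √(H : ℝ) * (condAvg (fun _ _ => Kernel.const Unit ν) f H () - ∫ x, f x ∂ν)
        = 0 := by
      intro H
      rcases Nat.eq_zero_or_pos H with rfl | hH
      · simp
      · have h0 : (H : ℝ) ≠ 0 := Nat.cast_ne_zero.2 hH.ne'
        simp [condAvg, h0]
    simp only [e]
    refine tendstoInDistribution_of_identDistrib 0 (fun _ => IdentDistrib.refl aemeasurable_const)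
      ⟨aemeasurable_const, aemeasurable_id, ?_⟩
    simp [Measure.map_const]

end OneLevel

/-! ### The test classes -/

section TestClass

variable {𝒞 : ℕ → Type*} [∀ t, MeasurableSpace (𝒞 t)]
  {π : ∀ t, Measure (𝒞 t)} {k : ∀ t, Kernel (𝒞 t) (𝒞 (t + 1) × PosWeight)} {z : ℕ → ℝ} {T : ℕ}

lemma testClass_memLp {l : ℕ} {φ : 𝒞 l → ℝ} (h : φ ∈ testClass π k z l) : MemLp φ 2 (π l) := by
  cases l with
  | zero => exact h
  | succ l => exact h.1

/-- The test classes are stable under differences with scalar multiples, and under modification on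
null sets. The latter is needed because conditional expectations of differences are differences of
conditional expectations only almost everywhere. -/
lemma testClass_of_ae_eq_sub [∀ t, IsProbabilityMeasure (π t)] [∀ t, IsMarkovKernel (k t)]
    (hunb : ∀ t < T, UnbiasedWeights (π t) (k t) (z (t + 1)) (π (t + 1))) (c : ℝ) {l : ℕ}
    (hl : l ≤ T) {φ φ₁ φ₂ : 𝒞 l → ℝ} (h₁ : φ₁ ∈ testClass π k z l) (h₂ : φ₂ ∈ testClass π k z l)
    (h : φ =ᵐ[π l] fun x => φ₁ x - c * φ₂ x) : φ ∈ testClass π k z l := by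
  induction l with
  | zero =>
    have h3 : MemLp (fun x => φ₁ x - c * φ₂ x) 2 (π 0) :=
      (testClass_memLp h₁).sub ((testClass_memLp h₂).const_mul c)
    exact h3.ae_eq h.symm
  | succ l ih =>
    obtain ⟨a₁, b₁, d₁⟩ := h₁
    obtain ⟨a₂, b₂, d₂⟩ := h₂
    have hV : (fun x : 𝒞 (l + 1) × PosWeight => normWeight (z (l + 1)) x * φ x.1)
        =ᵐ[k l ∘ₘ π l] fun x => normWeight (z (l + 1)) x * φ₁ x.1
          - c * (normWeight (z (l + 1)) x * φ₂ x.1) := by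
      filter_upwards [(hunb l hl).ae_comp_fst h] with x hx
      rw [hx]
      ring
    have h3 : MemLp (fun x => φ₁ x - c * φ₂ x) 2 (π (l + 1)) := a₁.sub (a₂.const_mul c)
    have h4 : MemLp (fun x : 𝒞 (l + 1) × PosWeight => normWeight (z (l + 1)) x * φ₁ x.1
          - c * (normWeight (z (l + 1)) x * φ₂ x.1)) 2 (k l ∘ₘ π l) := d₁.sub (d₂.const_mul c)
    refine ⟨h3.ae_eq h.symm, ih (by omega) b₁ b₂ ?_, h4.ae_eq hV.symm⟩
    filter_upwards [Measure.ae_ae_of_ae_comp hV,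
      Measure.ae_integrable_of_integrable_comp (d₁.integrable one_le_two),
      Measure.ae_integrable_of_integrable_comp (d₂.integrable one_le_two)] with y hy i₁ i₂
    rw [integral_congr_ae hy, integral_sub i₁ (i₂.const_mul c), integral_const_mul]

end TestClass

/-! ### The algorithm -/

section Algorithm

variable {𝒞 : ℕ → Type*} [∀ t, MeasurableSpace (𝒞 t)] {Ω : Type*} [mΩ : MeasurableSpace Ω]
  {P : Measure Ω} {T : ℕ} {π : ∀ t, Measure (𝒞 t)}
  {k : ∀ t, Kernel (𝒞 t) (𝒞 (t + 1) × PosWeight)} {z : ℕ → ℝ}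
  {Chat : ∀ t H : ℕ, Fin H → Ω → 𝒞 t} {C : ∀ t H : ℕ, Fin H → Ω → 𝒞 (t + 1)}
  {W : ∀ _t H : ℕ, Fin H → Ω → PosWeight}

namespace IsRandomWeightSMC

lemma measurable_weighted (h : IsRandomWeightSMC Chat C W T (π 0) k P) {t : ℕ} (ht : t < T) (H : ℕ)
    (j : Fin H) : Measurable fun ω => (C t H j ω, W t H j ω) :=
  (h.measurable_particle t ht H j).prodMk (h.measurable_weight t ht H j)

lemma historyHat_le (h : IsRandomWeightSMC Chat C W T (π 0) k P) {t : ℕ} (ht : t ≤ T) (H : ℕ) :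
    historyHat Chat C W t H ≤ mΩ := by
  refine sup_le (iSup₂_le fun s hs => iSup_le fun j => ?_)
    (iSup₂_le fun s hs => iSup_le fun j => ?_)
  · exact (h.measurable_hat s (hs.trans ht) H j).comap_le
  · exact (h.measurable_weighted (hs.trans_le ht) H j).comap_le

lemma historyWeighted_le (h : IsRandomWeightSMC Chat C W T (π 0) k P) {t : ℕ} (ht : t < T) (H : ℕ) :
    historyWeighted Chat C W t H ≤ mΩ :=
  sup_le (h.historyHat_le ht.le H) (iSup_le fun j => (h.measurable_weighted ht H j).comap_le)

variable [IsProbabilityMeasure P] [∀ t, IsProbabilityMeasure (π t)]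

lemma initial_array (h : IsRandomWeightSMC Chat C W T (π 0) k P) :
    IsCondIndepArray P (π 0) (fun _ _ => ()) (fun H ω j => Chat 0 H j ω)
      (fun _ _ => Kernel.const Unit (π 0)) :=
  isCondIndepArray_iid (fun H => measurable_pi_lambda _ fun j => h.measurable_hat 0 (zero_le) H j)
    h.initial

variable [∀ t, IsMarkovKernel (k t)]

lemma mutation_array (h : IsRandomWeightSMC Chat C W T (π 0) k P) {t : ℕ} (ht : t < T)
    (hac : ∀ H j, P.map (Chat t H j) ≪ π t)
    (hlln : ∀ f : 𝒞 t → ℝ, Measurable f → Integrable f (π t) →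
      TendstoInMeasure P (fun H ω => (∑ j, f (Chat t H j ω)) / H) atTop fun _ => ∫ c, f c ∂π t) :
    IsCondIndepArray P (k t ∘ₘ π t) (fun H ω j => Chat t H j ω)
      (fun H ω j => (C t H j ω, W t H j ω)) (mutationKernel (k t)) := by
  have hX : ∀ H, Measurable fun ω (j : Fin H) => (C t H j ω, W t H j ω) := fun H =>
    measurable_pi_lambda _ fun j => h.measurable_weighted ht H j
  refine isCondIndepArray_mutation (k t) (fun H j => h.measurable_hat t ht.le H j) hX hac hlln
    fun H => map_prodMk_of_hasCondLaw (h.historyHat_le ht.le H) ?_ (hX H) _ (h.mutation t ht H)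
  refine @measurable_pi_lambda _ _ _ (historyHat Chat C W t H) _ _ fun j => ?_
  refine (comap_measurable (Chat t H j)).mono ?_ le_rfl
  exact (le_iSup (fun j => MeasurableSpace.comap (Chat t H j) inferInstance) j).trans
    ((le_iSup₂ (f := fun s (_ : s ≤ t) => sigmaAlgHat Chat s H) t le_rfl).trans le_sup_left)

lemma selection_array (h : IsRandomWeightSMC Chat C W T (π 0) k P) {t : ℕ} (ht : t < T)
    (hunb : UnbiasedWeights (π t) (k t) (z (t + 1)) (π (t + 1)))
    (harr : IsCondIndepArray P (k t ∘ₘ π t) (fun H ω j => Chat t H j ω)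
      (fun H ω j => (C t H j ω, W t H j ω)) (mutationKernel (k t))) :
    IsCondIndepArray P (π (t + 1)) (fun H ω j => (C t H j ω, W t H j ω))
      (fun H ω j => Chat (t + 1) H j ω) (selectionKernel (𝒞 (t + 1))) := by
  have hA : ∀ H, Measurable fun ω (j : Fin H) => Chat (t + 1) H j ω := fun H =>
    measurable_pi_lambda _ fun j => h.measurable_hat (t + 1) ht H j
  refine isCondIndepArray_selection hunb harr.measurable_array hA
    (fun H j => harr.map_absolutelyContinuous H j)
    (fun f hf hi => harr.tendstoInMeasure_avg hf hi)
    fun H => map_prodMk_of_hasCondLaw (h.historyWeighted_le ht H) ?_ (hA H) _ (h.selection t ht H)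
  refine @measurable_pi_lambda _ _ _ (historyWeighted Chat C W t H) _ _ fun j => ?_
  refine (comap_measurable (fun ω => (C t H j ω, W t H j ω))).mono ?_ le_rfl
  exact (le_iSup (fun j => MeasurableSpace.comap (fun ω => (C t H j ω, W t H j ω)) inferInstance)
    j).trans le_sup_right

/-- On every level, the laws of the resampled particles are absolutely continuous with respect to
the target, and the weak law of large numbers holds. -/
lemma absolutelyContinuous_and_lln (h : IsRandomWeightSMC Chat C W T (π 0) k P)
    (hunb : ∀ t < T, UnbiasedWeights (π t) (k t) (z (t + 1)) (π (t + 1))) {t : ℕ} (ht : t ≤ T) :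
    (∀ H j, P.map (Chat t H j) ≪ π t) ∧
      ∀ f : 𝒞 t → ℝ, Measurable f → Integrable f (π t) →
        TendstoInMeasure P (fun H ω => (∑ j, f (Chat t H j ω)) / H) atTop
          fun _ => ∫ c, f c ∂π t := by
  induction t with
  | zero =>
    exact ⟨fun H j => h.initial_array.map_absolutelyContinuous H j,
      fun f hf hi => h.initial_array.tendstoInMeasure_avg hf hi⟩
  | succ t ih =>
    obtain ⟨hac, hlln⟩ := ih (by omega)
    have harr := h.selection_array ht (hunb t ht) (h.mutation_array ht hac hlln)
    exact ⟨fun H j => harr.map_absolutelyContinuous H j,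
      fun f hf hi => harr.tendstoInMeasure_avg hf hi⟩

/-- The central limit theorem is passed on from the resampled particles of level `t` to the weighted
particles of level `t + 1`. The test function may be modified on a null set. -/
lemma tendstoInDistribution_weighted (h : IsRandomWeightSMC Chat C W T (π 0) k P)
    (hunb : ∀ t < T, UnbiasedWeights (π t) (k t) (z (t + 1)) (π (t + 1))) {t : ℕ} (ht : t < T)
    (h1 : (fun _ => (1 : ℝ)) ∈ testClass π k z (t + 1)) {φ : 𝒞 (t + 1) → ℝ}
    (hφ : φ ∈ testClass π k z (t + 1)) {φ₁ : 𝒞 (t + 1) → ℝ} (hφ₁ : φ =ᵐ[π (t + 1)] φ₁)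
    (hclt : ∀ χ ∈ testClass π k z t, TendstoInDistribution
      (fun (H : ℕ) ω => √(H : ℝ) * ((∑ j, χ (Chat t H j ω)) / H - ∫ c, χ c ∂π t)) atTop
      (id : ℝ → ℝ) (fun _ => P) (gaussianReal 0 (sigmaHat π k z t χ).toNNReal)) :
    TendstoInDistribution
      (fun (H : ℕ) ω => √(H : ℝ) * (∑ j, (W t H j ω : ℝ) / (∑ l, (W t H l ω : ℝ)) * φ₁ (C t H j ω)
        - ∫ c, φ c ∂π (t + 1))) atTop (id : ℝ → ℝ) (fun _ => P)
      (gaussianReal 0 (sigma π k z t φ).toNNReal) := by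
  obtain ⟨hac, hlln⟩ := h.absolutelyContinuous_and_lln hunb ht.le
  have harr := h.mutation_array ht hac hlln
  have hu := hunb t ht
  set m := ∫ c, φ c ∂π (t + 1) with hm
  -- `φ` is only almost everywhere equal to a measurable function `φ'`.
  obtain ⟨φ', hφ'm, -, hae⟩ := exists_measurable_memLp_ae_eq (testClass_memLp hφ)
  have hφi : Integrable φ (π (t + 1)) := (testClass_memLp hφ).integrable one_le_two
  set ψ₀ : 𝒞 (t + 1) × PosWeight → ℝ := fun x => normWeight (z (t + 1)) x * (φ x.1 - m) with hψ₀
  set ψ : 𝒞 (t + 1) × PosWeight → ℝ := fun x => normWeight (z (t + 1)) x * (φ' x.1 - m) with hψ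
  have hψm : Measurable ψ :=
    (measurable_normWeight _).mul ((hφ'm.comp measurable_fst).sub_const m)
  have hψae : ψ₀ =ᵐ[k t ∘ₘ π t] ψ := by
    filter_upwards [hu.ae_comp_fst hae] with x hx
    simp only [hψ₀, hψ, hx]
  have hcl : (fun x => φ x - m) ∈ testClass π k z (t + 1) :=
    testClass_of_ae_eq_sub hunb m ht hφ h1 (.of_forall fun x => by simp)
  have hψ2 : MemLp ψ 2 (k t ∘ₘ π t) := hcl.2.2.ae_eq hψae
  have hψaeae := Measure.ae_ae_of_ae_comp hψae
  have hmean : (fun c => ∫ x, ψ₀ x ∂(k t c)) =ᵐ[π t] fun c => ∫ x, ψ x ∂(k t c) :=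
    hψaeae.mono fun c hc => integral_congr_ae hc
  have hvar : ∫ c, Var[ψ₀; k t c] ∂π t = ∫ c, Var[ψ; k t c] ∂π t :=
    integral_congr_ae (hψaeae.mono fun c hc => variance_congr hc)
  -- Unbiasedness makes the conditional means centred.
  have hzero : ∫ c, ∫ x, ψ₀ x ∂(k t c) ∂π t = 0 := by
    have hi := hu.integrable_normWeight_mul (φ := fun c => φ c - m) (hφi.sub (integrable_const m))
    rw [← integral_comp_measure hi,
      hu.integral_normWeight_mul (φ := fun c => φ c - m) (hφi.sub (integrable_const m)),
      integral_sub hφi (integrable_const m)]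
    simp [hm]
  have hw := hclt _ hcl.2.1
  rw [hzero] at hw
  have hw' : TendstoInDistribution (fun (H : ℕ) ω => √(H : ℝ) *
      ((∑ j, ∫ x, ψ x ∂(k t (Chat t H j ω))) / H - 0)) atTop (id : ℝ → ℝ) (fun _ => P)
      (gaussianReal 0 (sigmaHat π k z t fun c => ∫ x, ψ₀ x ∂(k t c)).toNNReal) := by
    refine TendstoInDistribution.congr (fun H => ?_) (ae_eq_refl _) hw
    filter_upwards [ae_forall_of_absolutelyContinuous (h.measurable_hat t ht.le H) (hac H) hmean]
      with ω hω
    rw [Finset.sum_congr rfl fun j _ => hω j]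
  have hmut := tendstoInDistribution_mutation harr hlln hψm hψ2 hw'
  rw [← hvar, ← Real.toNNReal_add (sigmaHat_nonneg π k z t _)
    (integral_nonneg fun _ => variance_nonneg _ _)] at hmut
  have hratio := tendstoInDistribution_ratio hu harr.measurable_array
    (fun f hf hi => harr.tendstoInMeasure_avg hf hi) m hmut
  refine TendstoInDistribution.congr (fun H => ?_) (ae_eq_refl _) hratio
  filter_upwards [ae_forall_of_absolutelyContinuous (h.measurable_weighted ht H)
    (harr.map_absolutelyContinuous H) (hu.ae_comp_fst (hae.symm.trans hφ₁))] with ω hω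
  rw [Finset.sum_congr rfl fun j _ => by rw [hω j]]

/-- The central limit theorem for the resampled particles. -/
lemma tendstoInDistribution_hat (h : IsRandomWeightSMC Chat C W T (π 0) k P)
    (hunb : ∀ t < T, UnbiasedWeights (π t) (k t) (z (t + 1)) (π (t + 1))) {t : ℕ} (ht : t ≤ T)
    (h1 : ∀ l ≤ t, (fun _ => (1 : ℝ)) ∈ testClass π k z l) {φ : 𝒞 t → ℝ}
    (hφ : φ ∈ testClass π k z t) :
    TendstoInDistribution
      (fun (H : ℕ) ω => √(H : ℝ) * ((∑ j, φ (Chat t H j ω)) / H - ∫ c, φ c ∂π t)) atTop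
      (id : ℝ → ℝ) (fun _ => P) (gaussianReal 0 (sigmaHat π k z t φ).toNNReal) := by
  induction t with
  | zero =>
    have hac := (h.absolutelyContinuous_and_lln hunb ht).1
    obtain ⟨φ', hφ'm, hφ2, hae⟩ := exists_measurable_memLp_ae_eq (testClass_memLp hφ)
    have := tendstoInDistribution_iid h.initial_array hφ'm hφ2
    rw [← integral_congr_ae hae, ← variance_congr hae] at this
    exact TendstoInDistribution.congr (fun H => ae_avg_eq (h.measurable_hat _ ht H) (hac H) hae _)
      (ae_eq_refl _) this
  | succ t ih =>
    have hac' := (h.absolutelyContinuous_and_lln hunb ht).1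
    obtain ⟨φ', hφ'm, hφ2, hae⟩ := exists_measurable_memLp_ae_eq (testClass_memLp hφ)
    obtain ⟨hac, hlln⟩ := h.absolutelyContinuous_and_lln hunb (Nat.le_of_succ_le ht)
    have harr := h.selection_array ht (hunb t ht) (h.mutation_array ht hac hlln)
    have hw := h.tendstoInDistribution_weighted hunb ht (h1 _ le_rfl) hφ hae fun χ hχ =>
      ih (Nat.le_of_succ_le ht) (fun l hl => h1 l (Nat.le_succ_of_le hl)) hχ
    have := tendstoInDistribution_selection harr hφ'm hφ2 hw
    rw [← Real.toNNReal_add (sigma_nonneg π k z t φ) (variance_nonneg _ _), ← variance_congr hae]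
      at this
    exact TendstoInDistribution.congr
      (fun H => ae_avg_eq (h.measurable_hat _ ht H) (hac' H) hae _) (ae_eq_refl _) this

end IsRandomWeightSMC
end Algorithm

end RWSMC

end

theorem theorem2 {𝒞 : ℕ → Type*} [∀ t, MeasurableSpace (𝒞 t)]
    {Ω : Type*} [MeasurableSpace Ω] (P : Measure Ω) [IsProbabilityMeasure P]
    (T : ℕ)
    (π : ∀ t, Measure (𝒞 t)) [∀ t, IsProbabilityMeasure (π t)]
    (k : ∀ t, Kernel (𝒞 t) (𝒞 (t + 1) × RWSMC.PosWeight)) [∀ t, IsMarkovKernel (k t)]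
    (z : ℕ → ℝ)
    (hunb : ∀ t < T, RWSMC.UnbiasedWeights (π t) (k t) (z (t + 1)) (π (t + 1)))
    (Chat : ∀ t H : ℕ, Fin H → Ω → 𝒞 t)
    (C : ∀ t H : ℕ, Fin H → Ω → 𝒞 (t + 1))
    (W : ∀ t H : ℕ, Fin H → Ω → RWSMC.PosWeight)
    (halg : RWSMC.IsRandomWeightSMC Chat C W T (π 0) k P) :
    (∀ t < T, (∀ l ≤ t + 1, (fun _ => (1 : ℝ)) ∈ RWSMC.testClass π k z l) →
      ∀ φ ∈ RWSMC.testClass π k z (t + 1),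
        TendstoInDistribution
          (fun (H : ℕ) (ω : Ω) => √(H : ℝ) *
            (∑ j, (W t H j ω : ℝ) / (∑ l, (W t H l ω : ℝ)) * φ (C t H j ω)
              - ∫ c, φ c ∂π (t + 1)))
          atTop (id : ℝ → ℝ) (fun _ => P)
          (gaussianReal 0 (RWSMC.sigma π k z t φ).toNNReal)) ∧
    (∀ t ≤ T, (∀ l ≤ t, (fun _ => (1 : ℝ)) ∈ RWSMC.testClass π k z l) →
      ∀ φ ∈ RWSMC.testClass π k z t,
        TendstoInDistribution
          (fun (H : ℕ) (ω : Ω) => 1 / √(H : ℝ) *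
            ∑ j, (φ (Chat t H j ω) - ∫ c, φ c ∂π t))
          atTop (id : ℝ → ℝ) (fun _ => P)
          (gaussianReal 0 (RWSMC.sigmaHat π k z t φ).toNNReal)) := by
  refine ⟨fun _ ht h1 φ hφ => ?_, fun _ ht h1 φ hφ => ?_⟩
  · exact halg.tendstoInDistribution_weighted hunb ht (h1 _ le_rfl) hφ (ae_eq_refl _)
      fun _ hχ => halg.tendstoInDistribution_hat hunb ht.le
        (fun l hl => h1 l (Nat.le_succ_of_le hl)) hχ
  · refine TendstoInDistribution.congr (fun H => .of_forall fun ω => ?_) (ae_eq_refl _)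
      (halg.tendstoInDistribution_hat hunb ht h1 hφ)
    -- For `H = 0` both sides are zero, since `√0 = 0` and the sum is empty.
    rcases Nat.eq_zero_or_pos H with rfl | hH
    · simp
    · have h0 : (H : ℝ) ≠ 0 := Nat.cast_ne_zero.2 hH.ne'
      simp only [Finset.sum_sub_distrib, Finset.sum_const, Finset.card_univ, Fintype.card_fin,
        nsmul_eq_mul]
      rw [← Real.sqrt_div_self', div_mul_eq_mul_div, mul_div_assoc, sub_div,
        mul_div_cancel_left₀ _ h0]
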